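/- Consider in $\mathbb R^2$ the equations of rotational gas dynamics $$\partial_t(\varrho u)+\mathrm{div}(\varrho u\otimes u)+l\varrho\,\mathcal L u+\nabla p=0,\quad \partial_t\varrho+\mathrm{div}(\varrho u)=0,\quad \partial_t S+u\cdot\nabla S=0,\quad p=e^{S}\varrho^{\gamma},$$ where $\mathcal L(u_1,u_2)=(-u_2,u_1)$, $l\ge 0$ is constant and $1<\gamma<2$, with $C^1$ initial data $(u_0,\varrho_0,p_0)$ such that $\varrho_0,p_0>0$ and $(u_0,\varrho_0,p_0)(x)=(0,\bar\varrho,\bar p)$ for $|x|\ge R$, where $R,\bar\varrho,\bar p>0$ are constants. Let $\bar S=\ln(\bar p\bar\varrho^{-\gamma})$ and $\sigma=(\gamma e^{\bar S}\bar\varrho^{\gamma-1})^{1/2}$, write $r(t)=R+\sigma t$ and $B_R(t)=\{|x|<r(t)\}$, and let $G(t)=\frac12\int_{B_R(t)}|x|^2\varrho\,dx$. The following quantities depend only on the data. Put $G(0)=\frac12\int_{|x|<R}|x|^2\varrho_0\,dx$, $F_1(0)=\int_{|x|<R}\varrho_0u_0\cdot x\,dx$, $F_2(0)=\int_{|x|<R}\varrho_0u_0\cdot(x_2,-x_1)\,dx$,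 $e(0)=\frac12\int_{|x|<R}\varrho_0|u_0|^2dx+\frac1{\gamma-1}\int_{|x|<R}(p_0-\bar p)\,dx$, $m(0)=\int_{|x|<R}(\varrho_0-\bar\varrho)\,dx$, $P(0)=\int_{|x|<R}\varrho_0x\,dx$, $I(0)=\int_{|x|<R}\varrho_0u_0\,dx$, and $G'(0)=F_1(0)+\pi\bar\varrho\sigma R^3$. Put $I_1(t)=I_1(0)\cos lt+I_2(0)\sin lt$, $I_2(t)=I_2(0)\cos lt-I_1(0)\sin lt$, $P(t)=P(0)+\int_0^tI(\tau)\,d\tau$, $$\phi_-(t)=\frac{|P(t)|^2}{2\,(m(0)+\pi\bar\varrho\, r(t)^2)},\qquad \phi_+(t)=\frac{r(t)^2}{2}\,(m(0)+\pi\bar\varrho\, r(t)^2),$$ $$q(t)=\tfrac{l^2\pi\bar\varrho}{4}(r(t)^4-R^4)+3\pi\bar\varrho\sigma^2r(t)^2,\qquad A_0=2(\gamma-1)e(0)+l^2G(0)-lF_2(0),$$ $$A_1=2e(0)+l^2G(0)-lF_2(0)+\tfrac{2(\gamma-2)}{\gamma-1}\sigma^2m(0),$$ $$g_-(t)=\int_0^t\!\int_0^\tau(q(\lambda)-l^2\phi_+(\lambda))\,d\lambda\,d\tau+\tfrac{A_0}{2}t^2+G'(0)t+G(0),$$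 $$g_+(t)=\int_0^t\!\int_0^\tau q(\lambda)\,d\lambda\,d\tau+\tfrac{A_1}{2}t^2+G'(0)t+G(0).$$ Assume that $S_0(x)=\ln(p_0(x)\varrho_0(x)^{-\gamma})\ge\bar S$ for all $x\in\mathbb R^2$. Then: (a) for every classical solution ($C^1$ on $[0,T)\times\mathbb R^2$, with $\varrho,p>0$) the right derivative of $G$ at $t=0$ is the number $G'(0)$ above, and $g_-(t)\le G(t)\le g_+(t)$ for all $t\in[0,T)$; (b) if $T_*>0$ is such that $g_+(T_*)=\phi_-(T_*)$ or $g_-(T_*)=\phi_+(T_*)$, then the classical solution loses smoothness within a time less than $T_*$: every classical solution on a time interval $[0,T)$, $T>0$, has $T<T_*$. -/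

import Mathlib

open Set MeasureTheory

noncomputable section

namespace RotGas

/-- The Euclidean plane. -/
abbrev Plane : Type := EuclideanSpace ℝ (Fin 2)

/-- Spatial partial derivative `∂f/∂x_j` at `x`. -/
def pd (j : Fin 2) (f : Plane → ℝ) (x : Plane) : ℝ :=
  fderiv ℝ f x (EuclideanSpace.single j 1)

/-- `𝓛 v`, where `𝓛` is the matrix with rows `(0, -1)` and `(1, 0)`. -/
def rot (v : Plane) : Plane := !₂[-v 1, v 0]

/-- `x_⊥ = (x₂, -x₁)`. -/
def perp (x : Plane) : Plane := !₂[x 1, -x 0]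

/-- The physical parameters and the Cauchy data: `γ > 1` the heat ratio, `l ≥ 0` the Coriolis
parameter, and `C¹` data with positive density and pressure which, outside the disc of radius `R`,
are the state of rest with constant positive density `rhoBar` and pressure `pBar`. -/
structure CauchyData where
  γ : ℝ
  l : ℝ
  R : ℝ
  rhoBar : ℝ
  pBar : ℝ
  u0 : Plane → Plane
  rho0 : Plane → ℝ
  p0 : Plane → ℝ
  one_lt_γ : 1 < γ
  l_nonneg : 0 ≤ l
  R_pos : 0 < R
  rhoBar_pos : 0 < rhoBar
  pBar_pos : 0 < pBar
  contDiff_u0 : ContDiff ℝ 1 u0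
  contDiff_rho0 : ContDiff ℝ 1 rho0
  contDiff_p0 : ContDiff ℝ 1 p0
  rho0_pos : ∀ x, 0 < rho0 x
  p0_pos : ∀ x, 0 < p0 x
  u0_outside : ∀ x, x ∉ Metric.ball (0 : Plane) R → u0 x = 0
  rho0_outside : ∀ x, x ∉ Metric.ball (0 : Plane) R → rho0 x = rhoBar
  p0_outside : ∀ x, x ∉ Metric.ball (0 : Plane) R → p0 x = pBar

/-- The entropy `S = ln (p ϱ^{-γ})` of a state with density `r > 0` and pressure `p > 0`. -/
def entropy (γ r p : ℝ) : ℝ := Real.log (p * r ^ (-γ))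

/-- For positive density and pressure, the definition of the entropy is the state equation
`p = exp S · ϱ^γ`. -/
theorem state_equation (γ r p : ℝ) (hr : 0 < r) (hp : 0 < p) :
    p = Real.exp (entropy γ r p) * r ^ γ := by
  have h : 0 < r ^ (-γ) := Real.rpow_pos_of_pos hr _
  rw [entropy, Real.exp_log (mul_pos hp h), mul_assoc, ← Real.rpow_add hr]
  simp

/-- `(u, rho, p)` is a classical solution, on the time interval `[0, T)`, of the equations of
rotational gas dynamics with data `D`: the functions are `C¹` on `[0, T) × ℝ²`, density and
pressure are positive, the data are attained at `t = 0`, and the equations hold pointwise. -/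
structure IsClassicalSolution (D : CauchyData) (T : ℝ) (u : ℝ → Plane → Plane)
    (rho p : ℝ → Plane → ℝ) : Prop where
  contDiffOn_u : ContDiffOn ℝ 1 (fun q : ℝ × Plane => u q.1 q.2) (Ico 0 T ×ˢ univ)
  contDiffOn_rho : ContDiffOn ℝ 1 (fun q : ℝ × Plane => rho q.1 q.2) (Ico 0 T ×ˢ univ)
  contDiffOn_p : ContDiffOn ℝ 1 (fun q : ℝ × Plane => p q.1 q.2) (Ico 0 T ×ˢ univ)
  rho_pos : ∀ t ∈ Ico 0 T, ∀ x, 0 < rho t x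
  p_pos : ∀ t ∈ Ico 0 T, ∀ x, 0 < p t x
  u_init : ∀ x, u 0 x = D.u0 x
  rho_init : ∀ x, rho 0 x = D.rho0 x
  p_init : ∀ x, p 0 x = D.p0 x
  /-- `∂ₜ(ϱu) + div(ϱ u ⊗ u) + l ϱ 𝓛u + ∇p = 0` -/
  momentum : ∀ t ∈ Ioo 0 T, ∀ x, ∀ i : Fin 2,
    deriv (fun s => rho s x * u s x i) t
      + ∑ j : Fin 2, pd j (fun y => rho t y * u t y i * u t y j) x
      + rho t x * D.l * rot (u t x) i + pd i (p t) x = 0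
  /-- `∂ₜϱ + div(ϱu) = 0` -/
  continuity_eq : ∀ t ∈ Ioo 0 T, ∀ x,
    deriv (fun s => rho s x) t + ∑ j : Fin 2, pd j (fun y => rho t y * u t y j) x = 0
  /-- `∂ₜS + u·∇S = 0` -/
  entropy_eq : ∀ t ∈ Ioo 0 T, ∀ x,
    deriv (fun s => entropy D.γ (rho s x) (p s x)) t
      + ∑ j : Fin 2, u t x j * pd j (fun y => entropy D.γ (rho t y) (p t y)) x = 0

namespace CauchyData

variable (D : CauchyData)

/-- The entropy `S̄` of the constant state. -/
def SBar : ℝ := entropy D.γ D.rhoBar D.pBar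

/-- The sound speed of the constant state: `σ² = ∂p/∂ϱ = γ exp(S̄) ϱ̄^{γ-1}`. -/
def σ : ℝ := Real.sqrt (D.γ * Real.exp D.SBar * D.rhoBar ^ (D.γ - 1))

/-- The radius `R + σ t` of the disc `B_R(t)`. -/
def radius (t : ℝ) : ℝ := D.R + D.σ * t

/-- The disc `B_R(t)`. -/
def disc (t : ℝ) : Set Plane := Metric.ball 0 (D.radius t)

/-- `G(t) = ½ ∫_{B_R(t)} |x|² ϱ dx`. -/
def G (rho : ℝ → Plane → ℝ) (t : ℝ) : ℝ :=
  1 / 2 * ∫ x in D.disc t, ‖x‖ ^ 2 * rho t x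

/-- `G(0)`, in terms of the data. -/
def G0 : ℝ := 1 / 2 * ∫ x in Metric.ball (0 : Plane) D.R, ‖x‖ ^ 2 * D.rho0 x

/-- `F₁(0) = ∫ ϱ₀ u₀·x`. -/
def F1 : ℝ := ∫ x in Metric.ball (0 : Plane) D.R, D.rho0 x * inner ℝ (D.u0 x) x

/-- `F₂(0) = ∫ ϱ₀ u₀·x_⊥`. -/
def F2 : ℝ := ∫ x in Metric.ball (0 : Plane) D.R, D.rho0 x * inner ℝ (D.u0 x) (perp x)

/-- The initial kinetic energy `E_k(0)`. -/
def Ek : ℝ := 1 / 2 * ∫ x in Metric.ball (0 : Plane) D.R, D.rho0 x * ‖D.u0 x‖ ^ 2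

/-- `e(0) = E_k(0) + (γ-1)⁻¹ ∫ (p₀ - p̄)`. -/
def e : ℝ := D.Ek + 1 / (D.γ - 1) * ∫ x in Metric.ball (0 : Plane) D.R, (D.p0 x - D.pBar)

/-- `m(0) = ∫ (ϱ₀ - ϱ̄)`. -/
def m : ℝ := ∫ x in Metric.ball (0 : Plane) D.R, (D.rho0 x - D.rhoBar)

/-- `P_i(0) = ∫ ϱ₀ x_i`. -/
def P0 (i : Fin 2) : ℝ := ∫ x in Metric.ball (0 : Plane) D.R, D.rho0 x * x i

/-- `I_i(0) = ∫ ϱ₀ u_{0,i}`. -/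
def I0 (i : Fin 2) : ℝ := ∫ x in Metric.ball (0 : Plane) D.R, D.rho0 x * D.u0 x i

/-- `I₁(t) = I₁(0) cos lt + I₂(0) sin lt`, the first component of the total momentum. -/
def I1 (t : ℝ) : ℝ := D.I0 0 * Real.cos (D.l * t) + D.I0 1 * Real.sin (D.l * t)

/-- `I₂(t) = I₂(0) cos lt - I₁(0) sin lt`, the second component of the total momentum. -/
def I2 (t : ℝ) : ℝ := D.I0 1 * Real.cos (D.l * t) - D.I0 0 * Real.sin (D.l * t)

/-- `P₁(t) = P₁(0) + ∫₀ᵗ I₁`. -/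
def P1 (t : ℝ) : ℝ := D.P0 0 + ∫ s in (0 : ℝ)..t, D.I1 s

/-- `P₂(t) = P₂(0) + ∫₀ᵗ I₂`. -/
def P2 (t : ℝ) : ℝ := D.P0 1 + ∫ s in (0 : ℝ)..t, D.I2 s

/-- The lower bound
`φ₋(t) = |P(t)|² / (2 (m(0) + π ϱ̄ (R + σt)²))`. -/
def phiMinus (t : ℝ) : ℝ :=
  (D.P1 t ^ 2 + D.P2 t ^ 2) / (2 * (D.m + D.rhoBar * Real.pi * D.radius t ^ 2))

/-- The upper bound `φ₊(t) = ½ (R + σt)² (m(0) + π ϱ̄ (R + σt)²)`. -/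
def phiPlus (t : ℝ) : ℝ :=
  D.radius t ^ 2 / 2 * (D.m + D.rhoBar * Real.pi * D.radius t ^ 2)

/-- `G'(0)`, in terms of the data. -/
def dG0 : ℝ := D.F1 + Real.pi * D.rhoBar * D.σ * D.R ^ 3

/-- `A₀ = 2(γ-1) e(0) + l² G(0) - l F₂(0)`. -/
def A0 : ℝ := 2 * (D.γ - 1) * D.e + D.l ^ 2 * D.G0 - D.l * D.F2

/-- `A₁ = 2 e(0) + l² G(0) - l F₂(0) + 2(γ-2)/(γ-1) σ² m(0)`. -/
def A1 : ℝ :=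
  2 * D.e + D.l ^ 2 * D.G0 - D.l * D.F2 + 2 * (D.γ - 2) / (D.γ - 1) * D.σ ^ 2 * D.m

/-- `q(t) = ¼ l² π ϱ̄ ((R + σt)⁴ - R⁴) + 3 π ϱ̄ σ² (R + σt)²`. -/
def q (t : ℝ) : ℝ :=
  D.l ^ 2 * Real.pi * D.rhoBar / 4 * (D.radius t ^ 4 - D.R ^ 4)
    + 3 * Real.pi * D.rhoBar * D.σ ^ 2 * D.radius t ^ 2

/-- `Q(t) = ∫₀ᵗ ∫₀^τ q(λ) dλ dτ`. -/
def Q (t : ℝ) : ℝ := ∫ τ in (0 : ℝ)..t, ∫ s in (0 : ℝ)..τ, D.q s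

/-- `Q₁(t) = ∫₀ᵗ ∫₀^τ (q(λ) - l² φ₊(λ)) dλ dτ`. -/
def Q1 (t : ℝ) : ℝ :=
  ∫ τ in (0 : ℝ)..t, ∫ s in (0 : ℝ)..τ, (D.q s - D.l ^ 2 * D.phiPlus s)

/-- `g₋(t) = Q₁(t) + ½ A₀ t² + G'(0) t + G(0)`. -/
def gMinus (t : ℝ) : ℝ := D.Q1 t + D.A0 / 2 * t ^ 2 + D.dG0 * t + D.G0

/-- `g₊(t) = Q(t) + ½ A₁ t² + G'(0) t + G(0)`. -/
def gPlus (t : ℝ) : ℝ := D.Q t + D.A1 / 2 * t ^ 2 + D.dG0 * t + D.G0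

end CauchyData

end RotGas

end

/-!
The moment of inertia `G` of the gas in the disc `B_R(t)` satisfies an explicit second-order
differential equation, and the two bounds `g₋ ≤ G ≤ g₊` come from integrating it twice. The argument
has three ingredients.

*Finite speed of propagation* (`IsFlow.atRest_of_radius_le`): outside the disc of radius `R + σ t`
the flow remains at the constant state of rest. The perturbation `(u, p - p̄)` solves exactly a
linear symmetric hyperbolic system with coefficients given by the flow, whose energy
`½ ϱ |u|² + (p - p̄)² / (2 γ p)` is transported with speed at most `|u| + c`, where `c = √(γ p / ϱ)`.
In a backward cone of slope `k > σ` whose base lies outside `B_R(0)`, the energy therefore vanishes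
as long as `|u| + c ≤ k`; at a first time at which `|u| + c = k` somewhere in the cone, the flow
would still be at rest there by continuity, and `|u| + c = σ < k`, a contradiction. No bound on the
solution at infinity is needed, because every cone is compact.

*Integral identities.* All perturbations now have compact support, so multiplying the balance laws
by polynomials and integrating over the plane gives the conservation of mass and energy, the rotation
of the total momentum, the law of the centre of mass, and
`G'' = 2 E_k + 2 ∫ (p - p̄) - l F₂(0) + l² G(0) - l² G + q` (`IsFlow.hasDerivAt_derivG`).
Conservation of energy eliminates `∫ (p - p̄)` for the lower bound and `E_k` for the upper one. The
lower bound uses `E_k ≥ 0` and `G ≤ φ₊`. The upper bound uses `G ≥ 0` and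
`∫ (p - p̄) ≥ σ² m(0)` (`IsFlow.sq_σ_mul_m_le`), which follows from the convexity of `r ↦ r ^ γ` and
from `S ≥ S̄`; the latter persists because `∫ ϱ ((S̄ - S)₊)²` is conserved.

*Strictness.* One has `G - φ₋ = ½ ∫ ϱ |x - X|²`, with `X` the centre of mass, and
`φ₊ - G = ½ ∫ ϱ (r² - |x|²)`. Both are bounded below by a constant `δ > 0` on the whole interval
`[0, T)` (`IsFlow.exists_gap`): since `ϱ ^ γ ≤ exp (-S̄) p` and `∫ p` is bounded by the energy, the
mass can concentrate neither at a point nor on the bounding circle. The uniformity is what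
excludes `T = T_*`, where the solution is only defined for `t < T_*` and the bounds are compared in
the limit.
-/

noncomputable section

namespace RotGas

open Filter Topology

/-! ### The square of the positive part and integration by parts -/

theorem hasDerivAt_sq_max (y : ℝ) :
    HasDerivAt (fun y : ℝ => max y 0 ^ 2) (2 * max y 0) y := by
  rcases lt_trichotomy y 0 with h | h | h
  · have h1 : (fun y : ℝ => max y 0 ^ 2) =ᶠ[𝓝 y] fun _ => 0 := by
      filter_upwards [Iio_mem_nhds h] with z hz
      simp [max_eq_right (le_of_lt (mem_Iio.1 hz))]
    rw [max_eq_right h.le, mul_zero]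
    exact (hasDerivAt_const y (0 : ℝ)).congr_of_eventuallyEq h1
  · subst h
    rw [max_self, mul_zero]
    have hO : (fun y : ℝ => max y 0 ^ 2) =O[𝓝 0] fun y => ‖y - 0‖ ^ 2 := by
      refine Asymptotics.isBigO_of_le _ fun z => ?_
      rw [norm_pow, norm_pow, norm_norm, sub_zero]
      gcongr
      rw [Real.norm_eq_abs, Real.norm_eq_abs, abs_of_nonneg (le_max_right z 0)]
      exact max_le (le_abs_self z) (abs_nonneg z)
    simpa using (hO.hasFDerivAt (n := 2) (by norm_num)).hasDerivAt
  · have h1 : (fun y : ℝ => max y 0 ^ 2) =ᶠ[𝓝 y] fun y => y ^ 2 := by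
      filter_upwards [Ioi_mem_nhds h] with z hz
      rw [max_eq_left (le_of_lt (mem_Ioi.1 hz))]
    rw [max_eq_left h.le]
    simpa using (hasDerivAt_pow 2 y).congr_of_eventuallyEq h1

theorem contDiff_sq_max : ContDiff ℝ 1 (fun y : ℝ => max y 0 ^ 2) := by
  rw [contDiff_one_iff_deriv]
  refine ⟨fun y => (hasDerivAt_sq_max y).differentiableAt, ?_⟩
  rw [show deriv (fun y : ℝ => max y 0 ^ 2) = fun y => 2 * max y 0 from
    funext fun y => (hasDerivAt_sq_max y).deriv]
  fun_prop

theorem integral_fderiv_eq_zero {g : Plane → ℝ} (hg : ContDiff ℝ 1 g) (hc : HasCompactSupport g)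
    (v : Plane) : ∫ x, fderiv ℝ g x v = 0 := by
  have hd := hg.differentiable (by norm_num)
  have h := integral_mul_fderiv_eq_neg_fderiv_mul_of_integrable (μ := (volume : Measure Plane))
    (f := fun _ => (1 : ℝ)) (g := g) (v := v)
    (by simp) (by
      simp only [one_mul]
      exact ((hg.continuous_fderiv (by norm_num)).clm_apply
        continuous_const).integrable_of_hasCompactSupport (hc.fderiv_apply ℝ v))
    (by simpa using hg.continuous.integrable_of_hasCompactSupport hc)
    (fun _ _ => differentiableAt_const _) (fun x _ => hd x)
  simpa using h

/-! ### Functions on space-time -/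

/-- The space-time slab `[0, T) × ℝ²`. -/
def slab (T : ℝ) : Set (ℝ × Plane) := Ico 0 T ×ˢ univ

/-- Time derivative of a function on space-time; meaningful in the interior of a slab. -/
def dT (F : ℝ × Plane → ℝ) (z : ℝ × Plane) : ℝ := fderiv ℝ F z (1, 0)

/-- Spatial partial derivative of a function on space-time; meaningful in the interior of a slab. -/
def dX (j : Fin 2) (F : ℝ × Plane → ℝ) (z : ℝ × Plane) : ℝ :=
  fderiv ℝ F z (0, EuclideanSpace.single j 1)

theorem slab_mono {S T : ℝ} (h : S ≤ T) : slab S ⊆ slab T :=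
  prod_mono (Ico_subset_Ico_right h) subset_rfl

theorem slab_mem_nhds {T t : ℝ} (ht : t ∈ Ioo 0 T) (x : Plane) : slab T ∈ 𝓝 (t, x) :=
  prod_mem_nhds (Ico_mem_nhds ht.1 ht.2) univ_mem

theorem uniqueDiffOn_slab (T : ℝ) : UniqueDiffOn ℝ (slab T) :=
  (uniqueDiffOn_Ico 0 T).prod uniqueDiffOn_univ

section C1

variable {T t : ℝ} {F : ℝ × Plane → ℝ}

theorem differentiableAt_of_slab (hF : ContDiffOn ℝ 1 F (slab T)) (ht : t ∈ Ioo 0 T) (x : Plane) :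
    DifferentiableAt ℝ F (t, x) :=
  (hF.contDiffAt (slab_mem_nhds ht x)).differentiableAt (by norm_num)

theorem continuousOn_fderiv_apply (hF : ContDiffOn ℝ 1 F (slab T)) (v : ℝ × Plane) :
    ContinuousOn (fun z => fderiv ℝ F z v) (Ioo 0 T ×ˢ univ) := by
  have ho : IsOpen (Ioo (0 : ℝ) T ×ˢ (univ : Set Plane)) := isOpen_Ioo.prod isOpen_univ
  have h := (hF.mono (prod_mono Ioo_subset_Ico_self subset_rfl)).continuousOn_fderiv_of_isOpen ho
    (by norm_num)
  exact h.clm_apply continuousOn_const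

theorem hasDerivAt_time {x : Plane} (hF : DifferentiableAt ℝ F (t, x)) :
    HasDerivAt (fun s => F (s, x)) (dT F (t, x)) t := by
  have h1 : HasDerivAt (fun s : ℝ => (s, x)) ((1 : ℝ), (0 : Plane)) t :=
    (hasDerivAt_id t).prodMk (hasDerivAt_const t x)
  exact hF.hasFDerivAt.comp_hasDerivAt t h1

theorem hasFDerivAt_space {x : Plane} (hF : DifferentiableAt ℝ F (t, x)) :
    HasFDerivAt (fun y => F (t, y))
      ((fderiv ℝ F (t, x)).comp (ContinuousLinearMap.inr ℝ ℝ Plane)) x :=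
  hF.hasFDerivAt.comp x (hasFDerivAt_prodMk_right t x)

theorem pd_eq_dX {x : Plane} (hF : DifferentiableAt ℝ F (t, x)) (j : Fin 2) :
    pd j (fun y => F (t, y)) x = dX j F (t, x) := by
  rw [pd, (hasFDerivAt_space hF).fderiv]
  simp [dX]

theorem contDiff_slice (hF : ContDiffOn ℝ 1 F (slab T)) (ht : t ∈ Ico 0 T) :
    ContDiff ℝ 1 (fun y => F (t, y)) := by
  rw [← contDiffOn_univ]
  exact hF.comp (contDiff_prodMk_right t).contDiffOn fun y _ => ⟨ht, mem_univ _⟩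

theorem integral_dX_eq_zero (hF : ContDiffOn ℝ 1 F (slab T)) (ht : t ∈ Ioo 0 T) {K : Set Plane}
    (hK : IsCompact K) (hFK : ∀ x ∉ K, F (t, x) = 0) (j : Fin 2) :
    Integrable (fun x => dX j F (t, x)) ∧ ∫ x, dX j F (t, x) = 0 := by
  have hc : ContDiff ℝ 1 (fun y => F (t, y)) := contDiff_slice hF ⟨ht.1.le, ht.2⟩
  have hs : HasCompactSupport (fun y => F (t, y)) := HasCompactSupport.intro hK hFK
  have he : (fun x => dX j F (t, x))
      = fun x => fderiv ℝ (fun y => F (t, y)) x (EuclideanSpace.single j 1) :=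
    funext fun x => (pd_eq_dX (differentiableAt_of_slab hF ht x) j).symm
  rw [he]
  exact ⟨((hc.continuous_fderiv (by norm_num)).clm_apply
        continuous_const).integrable_of_hasCompactSupport (hs.fderiv_apply ℝ _),
    integral_fderiv_eq_zero hc hs _⟩

end C1

/-! ### Integrated balance laws -/

/-- Integrated balance law: if `∂ₜf + div q = s`, with `f` and `q` vanishing
outside a fixed compact set, then the integral of `f` over the plane has derivative `∫ s`. -/
theorem balance_law {T : ℝ} {f s : ℝ × Plane → ℝ} {q : Fin 2 → ℝ × Plane → ℝ} {K : Set Plane}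
    (hK : IsCompact K) (hf : ContDiffOn ℝ 1 f (slab T)) (hq : ∀ j, ContDiffOn ℝ 1 (q j) (slab T))
    (hfK : ∀ t ∈ Ico 0 T, ∀ x ∉ K, f (t, x) = 0)
    (hqK : ∀ j, ∀ t ∈ Ico 0 T, ∀ x ∉ K, q j (t, x) = 0)
    (h : ∀ t ∈ Ioo 0 T, ∀ x, dT f (t, x) + ∑ j, dX j (q j) (t, x) = s (t, x)) :
    ContinuousOn (fun t => ∫ x, f (t, x)) (Ico 0 T) ∧
      ∀ t ∈ Ioo 0 T, Integrable (fun x => s (t, x)) ∧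
        HasDerivAt (fun t => ∫ x, f (t, x)) (∫ x, s (t, x)) t := by
  refine ⟨continuousOn_integral_of_compact_support (f := fun t x => f (t, x)) hK hf.continuousOn
    fun t x ht hx => hfK t ht x hx, fun t ht => ?_⟩
  have hcl : IsClosed K := hK.isClosed
  have hdK : ∀ r ∈ Ioo 0 T, ∀ x ∉ K, dT f (r, x) = 0 := by
    intro r hr x hx
    have he : f =ᶠ[𝓝 (r, x)] fun _ => 0 := by
      filter_upwards [prod_mem_nhds (Ioo_mem_nhds hr.1 hr.2) (hcl.isOpen_compl.mem_nhds hx)]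
        with z hz
      exact hfK z.1 (Ioo_subset_Ico_self hz.1) z.2 hz.2
    rw [dT, he.fderiv_eq]
    simp
  -- a compact time interval around `t`, on which the time derivative is bounded
  obtain ⟨a, b, hat, hab⟩ : ∃ a b, t ∈ Ioo a b ∧ Icc a b ⊆ Ioo 0 T := by
    refine ⟨t / 2, (t + T) / 2, ⟨by linarith [ht.1], by linarith [ht.2]⟩, fun r hr => ⟨?_, ?_⟩⟩
    · linarith [hr.1, ht.1]
    · linarith [hr.2, ht.2]
  have hcont : ContinuousOn (dT f) (Ioo 0 T ×ˢ univ) := continuousOn_fderiv_apply hf _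
  obtain ⟨C, hC⟩ := (isCompact_Icc.prod hK).exists_bound_of_continuousOn
    (hcont.mono (prod_mono hab (subset_univ K)))
  have hslice : ∀ r ∈ Ioo 0 T, Continuous fun x => dT f (r, x) := fun r hr =>
    hcont.comp_continuous (by fun_prop) fun x => ⟨hr, mem_univ _⟩
  have hmain := hasDerivAt_integral_of_dominated_loc_of_deriv_le (μ := (volume : Measure Plane))
    (F := fun r x => f (r, x)) (F' := fun r x => dT f (r, x)) (x₀ := t) (s := Ioo a b)
    (bound := K.indicator fun _ => C) (Ioo_mem_nhds hat.1 hat.2)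
    (by
      filter_upwards [Ioo_mem_nhds ht.1 ht.2] with r hr
      exact (contDiff_slice hf (Ioo_subset_Ico_self hr)).continuous.aestronglyMeasurable)
    ((contDiff_slice hf (Ioo_subset_Ico_self ht)).continuous.integrable_of_hasCompactSupport
      (HasCompactSupport.intro hK (hfK t (Ioo_subset_Ico_self ht))))
    (hslice t ht).aestronglyMeasurable
    (by
      refine Eventually.of_forall fun x r hr => ?_
      by_cases hx : x ∈ K
      · rw [indicator_of_mem hx]
        exact hC (r, x) ⟨Ioo_subset_Icc_self hr, hx⟩
      · rw [indicator_of_notMem hx, hdK r (hab (Ioo_subset_Icc_self hr)) x hx, norm_zero])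
    ((integrable_indicator_iff hcl.measurableSet).2 (integrableOn_const hK.measure_ne_top))
    (Eventually.of_forall fun x r hr =>
      hasDerivAt_time (differentiableAt_of_slab hf (hab (Ioo_subset_Icc_self hr)) x))
  have hX : ∀ j, Integrable (fun x => dX j (q j) (t, x)) ∧ ∫ x, dX j (q j) (t, x) = 0 := fun j =>
    integral_dX_eq_zero (hq j) ht hK (hqK j t (Ioo_subset_Ico_self ht)) j
  simp_rw [← h t ht]
  refine ⟨hmain.1.add (integrable_finsetSum _ fun j _ => (hX j).1), ?_⟩
  have hs : ∫ x, (dT f (t, x) + ∑ j, dX j (q j) (t, x)) = ∫ x, dT f (t, x) := by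
    rw [integral_add hmain.1 (integrable_finsetSum _ fun j _ => (hX j).1),
      integral_finsetSum _ fun j _ => (hX j).1]
    simp [(hX _).2]
  rw [hs]
  exact hmain.2

/-- The balance law, multiplied by a weight `ψ`. -/
theorem weighted_balance_law {T : ℝ} {f s ψ : ℝ × Plane → ℝ} {q : Fin 2 → ℝ × Plane → ℝ}
    {K : Set Plane} (hK : IsCompact K) (hψ : ContDiff ℝ 1 ψ) (hf : ContDiffOn ℝ 1 f (slab T))
    (hq : ∀ j, ContDiffOn ℝ 1 (q j) (slab T))
    (hsupp : ∀ t ∈ Ico 0 T, ∀ x ∉ K, ψ (t, x) = 0 ∨ (f (t, x) = 0 ∧ ∀ j, q j (t, x) = 0))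
    (h : ∀ t ∈ Ioo 0 T, ∀ x, dT f (t, x) + ∑ j, dX j (q j) (t, x) = s (t, x)) :
    ContinuousOn (fun t => ∫ x, ψ (t, x) * f (t, x)) (Ico 0 T) ∧
      ∀ t ∈ Ioo 0 T, Integrable (fun x => ψ (t, x) * s (t, x) + dT ψ (t, x) * f (t, x)
          + ∑ j, dX j ψ (t, x) * q j (t, x)) ∧
        HasDerivAt (fun t => ∫ x, ψ (t, x) * f (t, x))
          (∫ x, (ψ (t, x) * s (t, x) + dT ψ (t, x) * f (t, x)
            + ∑ j, dX j ψ (t, x) * q j (t, x))) t := by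
  refine balance_law (f := fun z => ψ z * f z) (q := fun j z => ψ z * q j z)
    (s := fun z => ψ z * s z + dT ψ z * f z + ∑ j, dX j ψ z * q j z)
    hK (hψ.contDiffOn.mul hf) (fun j => hψ.contDiffOn.mul (hq j)) ?_ ?_ ?_
  · intro t ht x hx
    rcases hsupp t ht x hx with h0 | h0 <;> simp [h0]
  · intro j t ht x hx
    rcases hsupp t ht x hx with h0 | h0 <;> simp [h0]
  · intro t ht x
    have hψd : DifferentiableAt ℝ ψ (t, x) := hψ.differentiable (by norm_num) _
    have hmul : ∀ g, ContDiffOn ℝ 1 g (slab T) → ∀ v, fderiv ℝ (fun z => ψ z * g z) (t, x) v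
        = ψ (t, x) * fderiv ℝ g (t, x) v + fderiv ℝ ψ (t, x) v * g (t, x) := by
      intro g hg v
      rw [fderiv_fun_mul hψd (differentiableAt_of_slab hg ht x)]
      simp [mul_comm]
    simp only [← h t ht x, dT, dX, hmul f hf, hmul _ (hq _), Fin.sum_univ_two]
    ring

/-! ### Comparison of functions of time -/

/-- Grönwall's inequality for a nonnegative function with zero initial value. -/
theorem eq_zero_of_deriv_le_mul {T C : ℝ} {E E' : ℝ → ℝ} (hE : ContinuousOn E (Ico 0 T))
    (hd : ∀ t ∈ Ioo 0 T, HasDerivAt E (E' t) t) (hle : ∀ t ∈ Ioo 0 T, E' t ≤ C * E t)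
    (h0 : E 0 = 0) (hnn : ∀ t ∈ Ico 0 T, 0 ≤ E t) : ∀ t ∈ Ico 0 T, E t = 0 := by
  intro t ht
  have hT : 0 < T := ht.1.trans_lt ht.2
  have hanti : AntitoneOn (fun t => Real.exp (-C * t) * E t) (Ico 0 T) := by
    have hder : ∀ r ∈ Ioo 0 T, HasDerivAt (fun t => Real.exp (-C * t) * E t)
        (Real.exp (-C * r) * (E' r - C * E r)) r := by
      intro r hr
      have h1 : HasDerivAt (fun t => Real.exp (-C * t)) (Real.exp (-C * r) * (-C)) r := by
        simpa using ((hasDerivAt_id r).const_mul (-C)).exp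
      exact (h1.fun_mul (hd r hr)).congr_deriv (by ring)
    refine antitoneOn_of_deriv_nonpos (convex_Ico 0 T)
      ((by fun_prop : Continuous fun t => Real.exp (-C * t)).continuousOn.mul hE) ?_ ?_ <;>
      rw [interior_Ico] <;> intro r hr
    · exact (hder r hr).differentiableAt.differentiableWithinAt
    · rw [(hder r hr).deriv]
      exact mul_nonpos_of_nonneg_of_nonpos (Real.exp_pos _).le (by linarith [hle r hr])
  have h1 := hanti ⟨le_rfl, hT⟩ ht ht.1
  simp only [h0, mul_zero] at h1
  exact le_antisymm (nonpos_of_mul_nonpos_right h1 (Real.exp_pos _)) (hnn t ht)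

theorem le_of_hasDerivAt_le {T : ℝ} {f f' g g' : ℝ → ℝ} (hf : ContinuousOn f (Ico 0 T))
    (hg : ContinuousOn g (Ico 0 T)) (hf' : ∀ t ∈ Ioo 0 T, HasDerivAt f (f' t) t)
    (hg' : ∀ t ∈ Ioo 0 T, HasDerivAt g (g' t) t) (h0 : f 0 ≤ g 0)
    (hle : ∀ t ∈ Ioo 0 T, f' t ≤ g' t) : ∀ t ∈ Ico 0 T, f t ≤ g t := by
  intro t ht
  have hmono : MonotoneOn (fun t => g t - f t) (Ico 0 T) := by
    refine monotoneOn_of_deriv_nonneg (convex_Ico 0 T) (hg.sub hf) ?_ ?_ <;>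
      rw [interior_Ico] <;> intro r hr
    · exact ((hg' r hr).sub (hf' r hr)).differentiableAt.differentiableWithinAt
    · have := ((hg' r hr).sub (hf' r hr)).deriv
      rw [show (fun t => g t - f t) = g - f from rfl, this]
      linarith [hle r hr]
  have h1 := hmono ⟨le_rfl, ht.1.trans_lt ht.2⟩ ht ht.1
  simp only at h1
  linarith

theorem eq_of_hasDerivAt_eq {T : ℝ} {f g f' : ℝ → ℝ} (hf : ContinuousOn f (Ico 0 T))
    (hg : ContinuousOn g (Ico 0 T)) (hf' : ∀ t ∈ Ioo 0 T, HasDerivAt f (f' t) t)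
    (hg' : ∀ t ∈ Ioo 0 T, HasDerivAt g (f' t) t) (h0 : f 0 = g 0) :
    ∀ t ∈ Ico 0 T, f t = g t := fun t ht =>
  le_antisymm (le_of_hasDerivAt_le hf hg hf' hg' h0.le (fun _ _ => le_rfl) t ht)
    (le_of_hasDerivAt_le hg hf hg' hf' h0.ge (fun _ _ => le_rfl) t ht)

theorem hasDerivAt_integral_zero {k : ℝ → ℝ} (hk : Continuous k) (t : ℝ) :
    HasDerivAt (fun t => ∫ s in (0 : ℝ)..t, k s) (k t) t :=
  intervalIntegral.integral_hasDerivAt_right (hk.intervalIntegrable _ _)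
    (hk.stronglyMeasurableAtFilter _ _) hk.continuousAt

theorem continuous_integral_zero {k : ℝ → ℝ} (hk : Continuous k) :
    Continuous fun t => ∫ s in (0 : ℝ)..t, k s :=
  continuous_iff_continuousAt.2 fun t => (hasDerivAt_integral_zero hk t).continuousAt

/-! ### Integrals over discs -/

theorem volume_real_ball (x : Plane) {r : ℝ} (hr : 0 ≤ r) :
    volume.real (Metric.ball x r) = Real.pi * r ^ 2 := by
  rw [measureReal_def, EuclideanSpace.volume_ball_fin_two]
  simp [ENNReal.toReal_ofReal hr, mul_comm, Real.pi_pos.le]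

theorem integral_ball_norm_sq {r : ℝ} (hr : 0 ≤ r) :
    ∫ x in Metric.ball (0 : Plane) r, ‖x‖ ^ 2 = Real.pi * r ^ 4 / 2 := by
  have h := integral_fun_norm_addHaar (volume : Measure Plane)
    (fun y : ℝ => (Iio r).indicator (fun y => y ^ 2) y)
  have h1 : ∫ x : Plane, (Iio r).indicator (fun y => y ^ 2) ‖x‖
      = ∫ x in Metric.ball (0 : Plane) r, ‖x‖ ^ 2 := by
    rw [← integral_indicator measurableSet_ball]
    congr 1 with x
    by_cases hx : ‖x‖ < r
    · rw [indicator_of_mem (show ‖x‖ ∈ Iio r from hx), indicator_of_mem (by simpa using hx)]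
    · rw [indicator_of_notMem (show ‖x‖ ∉ Iio r from hx), indicator_of_notMem (by simpa using hx)]
  rw [← h1, h]
  have h2 : ∫ y in Ioi (0 : ℝ), y ^ (Module.finrank ℝ Plane - 1) •
      (Iio r).indicator (fun y => y ^ 2) y = ∫ y in (0 : ℝ)..r, y ^ 3 := by
    rw [intervalIntegral.integral_of_le hr, integral_Ioc_eq_integral_Ioo,
      ← integral_indicator measurableSet_Ioi, ← integral_indicator measurableSet_Ioo]
    congr 1 with y
    by_cases h0 : 0 < y <;> by_cases h1 : y < r <;> simp [indicator, h0, h1]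
    ring
  rw [h2, integral_pow, volume_real_ball 0 zero_le_one]
  simp
  ring

theorem integral_ball_coord (r : ℝ) (i : Fin 2) :
    ∫ x in Metric.ball (0 : Plane) r, x i = 0 := by
  have h : ∫ x in Metric.ball (0 : Plane) r, x i = -∫ x in Metric.ball (0 : Plane) r, x i := by
    rw [← integral_neg, ← integral_indicator measurableSet_ball,
      ← integral_indicator measurableSet_ball, ← integral_neg_eq_self]
    congr 1 with x
    by_cases hx : ‖x‖ < r
    · rw [indicator_of_mem (by simpa using hx), indicator_of_mem (by simpa using hx)]
      simp
    · rw [indicator_of_notMem (by simpa using hx), indicator_of_notMem (by simpa using hx)]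
  linarith

theorem integrableOn_ball {g : Plane → ℝ} (hg : Continuous g) (x : Plane) (r : ℝ) :
    IntegrableOn g (Metric.ball x r) :=
  (hg.continuousOn.integrableOn_compact (isCompact_closedBall x r)).mono_set
    Metric.ball_subset_closedBall

/-! ### The primitive form of the equations -/

/-- A classical solution on `[0, T)`, as functions on space-time and in primitive form:
`ϱ (∂ₜu + u·∇u) + l ϱ 𝓛u + ∇p = 0`, `∂ₜϱ + u·∇ϱ + ϱ div u = 0`, `∂ₜp + u·∇p + γ p div u = 0`, and
`∂ₜS + u·∇S = 0`. The pressure equation is a consequence of the mass and entropy equations. -/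
structure IsFlow (D : CauchyData) (T : ℝ) (U : Fin 2 → ℝ × Plane → ℝ) (ρ p : ℝ × Plane → ℝ) :
    Prop where
  contU : ∀ i, ContDiffOn ℝ 1 (U i) (slab T)
  contρ : ContDiffOn ℝ 1 ρ (slab T)
  contp : ContDiffOn ℝ 1 p (slab T)
  ρ_pos : ∀ z ∈ slab T, 0 < ρ z
  p_pos : ∀ z ∈ slab T, 0 < p z
  U_init : ∀ i x, U i (0, x) = D.u0 x i
  ρ_init : ∀ x, ρ (0, x) = D.rho0 x
  p_init : ∀ x, p (0, x) = D.p0 x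
  velocity : ∀ t ∈ Ioo 0 T, ∀ x, ∀ i,
    ρ (t, x) * (dT (U i) (t, x) + ∑ j, U j (t, x) * dX j (U i) (t, x))
      + D.l * ρ (t, x) * (![-U 1 (t, x), U 0 (t, x)] i) + dX i p (t, x) = 0
  mass : ∀ t ∈ Ioo 0 T, ∀ x,
    dT ρ (t, x) + ∑ j, (U j (t, x) * dX j ρ (t, x) + ρ (t, x) * dX j (U j) (t, x)) = 0
  pressure : ∀ t ∈ Ioo 0 T, ∀ x,
    dT p (t, x) + ∑ j, (U j (t, x) * dX j p (t, x) + D.γ * p (t, x) * dX j (U j) (t, x)) = 0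
  entropy_transport : ∀ t ∈ Ioo 0 T, ∀ x,
    dT (fun z => entropy D.γ (ρ z) (p z)) (t, x)
      + ∑ j, U j (t, x) * dX j (fun z => entropy D.γ (ρ z) (p z)) (t, x) = 0

theorem mem_slab {T t : ℝ} (ht : t ∈ Ico 0 T) (x : Plane) : (t, x) ∈ slab T := ⟨ht, mem_univ _⟩

theorem contDiffOn_entropy {γ : ℝ} {s : Set (ℝ × Plane)} {ρ p : ℝ × Plane → ℝ}
    (hρ : ContDiffOn ℝ 1 ρ s) (hp : ContDiffOn ℝ 1 p s) (hρ0 : ∀ z ∈ s, 0 < ρ z)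
    (hp0 : ∀ z ∈ s, 0 < p z) : ContDiffOn ℝ 1 (fun z => entropy γ (ρ z) (p z)) s :=
  (hp.mul (hρ.rpow_const_of_ne fun z hz => (hρ0 z hz).ne')).log fun z hz =>
    (mul_pos (hp0 z hz) (Real.rpow_pos_of_pos (hρ0 z hz) _)).ne'

theorem fderiv_entropy {γ : ℝ} {ρ p : ℝ × Plane → ℝ} {z : ℝ × Plane}
    (hρ : DifferentiableAt ℝ ρ z) (hp : DifferentiableAt ℝ p z) (hρ0 : 0 < ρ z) (hp0 : 0 < p z)
    (v : ℝ × Plane) : fderiv ℝ (fun z => entropy γ (ρ z) (p z)) z v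
      = fderiv ℝ p z v / p z - γ * fderiv ℝ ρ z v / ρ z := by
  have hr : 0 < ρ z ^ (-γ) := Real.rpow_pos_of_pos hρ0 _
  have h := ((hp.hasFDerivAt.fun_mul (hρ.hasFDerivAt.rpow_const (p := -γ) (Or.inl hρ0.ne'))).log
    (mul_pos hp0 hr).ne').fderiv
  unfold entropy
  rw [h]
  simp only [smul_apply, add_apply, smul_eq_mul,
    Real.rpow_sub_one hρ0.ne']
  field_simp
  ring

theorem IsClassicalSolution.isFlow {D : CauchyData} {T : ℝ} {u : ℝ → Plane → Plane}
    {rho p : ℝ → Plane → ℝ} (h : IsClassicalSolution D T u rho p) :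
    IsFlow D T (fun i z => u z.1 z.2 i) (fun z => rho z.1 z.2) (fun z => p z.1 z.2) := by
  set U : Fin 2 → ℝ × Plane → ℝ := fun i z => u z.1 z.2 i with hU
  set R : ℝ × Plane → ℝ := fun z => rho z.1 z.2 with hR
  set P : ℝ × Plane → ℝ := fun z => p z.1 z.2 with hP
  have cU : ∀ i, ContDiffOn ℝ 1 (U i) (slab T) := fun i => contDiffOn_euclidean.1 h.contDiffOn_u i
  have cR : ContDiffOn ℝ 1 R (slab T) := h.contDiffOn_rho
  have cP : ContDiffOn ℝ 1 P (slab T) := h.contDiffOn_p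
  have pR : ∀ z ∈ slab T, 0 < R z := fun z hz => h.rho_pos z.1 hz.1 z.2
  have pP : ∀ z ∈ slab T, 0 < P z := fun z hz => h.p_pos z.1 hz.1 z.2
  have dmul : ∀ {F G : ℝ × Plane → ℝ}, ContDiffOn ℝ 1 F (slab T) → ContDiffOn ℝ 1 G (slab T) →
      ∀ t ∈ Ioo 0 T, ∀ x v, fderiv ℝ (fun z => F z * G z) (t, x) v
        = F (t, x) * fderiv ℝ G (t, x) v + G (t, x) * fderiv ℝ F (t, x) v := by
    intro F G hF hG t ht x v
    rw [fderiv_fun_mul (differentiableAt_of_slab hF ht x) (differentiableAt_of_slab hG ht x)]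
    simp
  have time : ∀ {F : ℝ × Plane → ℝ}, ContDiffOn ℝ 1 F (slab T) → ∀ t ∈ Ioo 0 T, ∀ x,
      deriv (fun s => F (s, x)) t = dT F (t, x) := fun hF t ht x =>
    (hasDerivAt_time (differentiableAt_of_slab hF ht x)).deriv
  have space : ∀ {F : ℝ × Plane → ℝ}, ContDiffOn ℝ 1 F (slab T) → ∀ t ∈ Ioo 0 T, ∀ x j,
      pd j (fun y => F (t, y)) x = dX j F (t, x) := fun hF t ht x j =>
    pd_eq_dX (differentiableAt_of_slab hF ht x) j
  have mass : ∀ t ∈ Ioo 0 T, ∀ x, dT R (t, x)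
      + ∑ j, (U j (t, x) * dX j R (t, x) + R (t, x) * dX j (U j) (t, x)) = 0 := by
    intro t ht x
    have h1 := h.continuity_eq t ht x
    have h2 := time cR t ht x
    have h3 := fun j => space (cR.mul (cU j)) t ht x j
    simp only [hR, hU] at h2 h3
    simp only [h2, h3] at h1
    simp only [dT, dX, Fin.sum_univ_two] at h1 ⊢
    rw [dmul cR (cU 0) t ht, dmul cR (cU 1) t ht] at h1
    linear_combination h1
  have entr : ∀ t ∈ Ioo 0 T, ∀ x, dT (fun z => entropy D.γ (R z) (P z)) (t, x)
      + ∑ j, U j (t, x) * dX j (fun z => entropy D.γ (R z) (P z)) (t, x) = 0 := by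
    intro t ht x
    have h1 := h.entropy_eq t ht x
    have c := contDiffOn_entropy (γ := D.γ) cR cP pR pP
    have h2 := time c t ht x
    have h3 := fun j => space c t ht x j
    simp only [hR, hP] at h2 h3
    simp only [h2, h3] at h1
    exact h1
  refine ⟨cU, cR, cP, pR, pP, fun i x => by simp [hU, h.u_init], fun x => h.rho_init x,
    fun x => h.p_init x, ?_, mass, ?_, entr⟩
  · intro t ht x i
    have h1 := h.momentum t ht x i
    have h2 := time (cR.mul (cU i)) t ht x
    have h3 := fun j => space ((cR.mul (cU i)).mul (cU j)) t ht x j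
    have h4 := space cP t ht x i
    have hm := mass t ht x
    have h5 : rot (u t x) i = ![-U 1 (t, x), U 0 (t, x)] i := by
      fin_cases i <;> rfl
    simp only [hR, hU, hP] at h2 h3 h4
    simp only [h2, h3, h4, h5] at h1
    simp only [dT, dX, Fin.sum_univ_two] at h1 hm ⊢
    have e0 := fun j => dmul (cR.mul (cU i)) (cU j) t ht x
    have e1 := dmul cR (cU i) t ht x
    rw [e0 0, e0 1, e1, e1, e1] at h1
    linear_combination h1 - U i (t, x) * hm
  · intro t ht x
    have h1 := entr t ht x
    have hm := mass t ht x
    have hR0 := pR _ (mem_slab (Ioo_subset_Ico_self ht) x)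
    have hP0 := pP _ (mem_slab (Ioo_subset_Ico_self ht) x)
    have hd := fderiv_entropy (γ := D.γ) (differentiableAt_of_slab cR ht x)
      (differentiableAt_of_slab cP ht x) hR0 hP0
    simp only [dT, dX, Fin.sum_univ_two, hd] at h1 hm ⊢
    field_simp at h1
    have h3 : R (t, x) ≠ 0 := hR0.ne'
    apply mul_left_cancel₀ h3
    linear_combination h1 + D.γ * P (t, x) * hm

/-! ### Pointwise balance laws -/

section Laws

variable {D : CauchyData} {T : ℝ} {U : Fin 2 → ℝ × Plane → ℝ} {ρ p : ℝ × Plane → ℝ}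

/-- The flux of the `i`-th component of the momentum, with the background pressure removed. -/
def momentumFlux (D : CauchyData) (U : Fin 2 → ℝ × Plane → ℝ) (ρ p : ℝ × Plane → ℝ) (i j : Fin 2)
    (z : ℝ × Plane) : ℝ :=
  ρ z * U i z * U j z + if i = j then p z - D.pBar else 0

/-- The total energy density, relative to the background pressure. -/
def energy (D : CauchyData) (U : Fin 2 → ℝ × Plane → ℝ) (ρ p : ℝ × Plane → ℝ)
    (z : ℝ × Plane) : ℝ :=
  1 / 2 * (ρ z * (U 0 z ^ 2 + U 1 z ^ 2)) + 1 / (D.γ - 1) * (p z - D.pBar)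

/-- The energy flux. -/
def energyFlux (D : CauchyData) (U : Fin 2 → ℝ × Plane → ℝ) (ρ p : ℝ × Plane → ℝ) (j : Fin 2)
    (z : ℝ × Plane) : ℝ :=
  (1 / 2 * (ρ z * (U 0 z ^ 2 + U 1 z ^ 2)) + D.γ / (D.γ - 1) * p z) * U j z

/-- The spatial density of the entropy deficit: `ϱ ((S̄ - S)₊)²`. -/
def entropyDeficit (D : CauchyData) (ρ p : ℝ × Plane → ℝ) (z : ℝ × Plane) : ℝ :=
  ρ z * max (D.SBar - entropy D.γ (ρ z) (p z)) 0 ^ 2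

/-- The acoustic energy density `½ ϱ |u|² + (p - p̄)² / (2 γ p)`: the energy of the symmetrized
linear system for `(u, p - p̄)`, whose coefficients are given by the flow. -/
def acousticEnergy (D : CauchyData) (U : Fin 2 → ℝ × Plane → ℝ) (ρ p : ℝ × Plane → ℝ)
    (z : ℝ × Plane) : ℝ :=
  1 / 2 * (ρ z * (U 0 z ^ 2 + U 1 z ^ 2)) + 1 / (2 * D.γ) * ((p z - D.pBar) ^ 2 / p z)

/-- The flux of the acoustic energy. -/
def acousticFlux (D : CauchyData) (U : Fin 2 → ℝ × Plane → ℝ) (ρ p : ℝ × Plane → ℝ) (j : Fin 2)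
    (z : ℝ × Plane) : ℝ :=
  (acousticEnergy D U ρ p z + (p z - D.pBar)) * U j z

namespace IsFlow

variable (h : IsFlow D T U ρ p)
include h

theorem contDiffOn_massFlux (j : Fin 2) : ContDiffOn ℝ 1 (fun z => ρ z * U j z) (slab T) :=
  h.contρ.mul (h.contU j)

theorem contDiffOn_momentumFlux (i j : Fin 2) :
    ContDiffOn ℝ 1 (momentumFlux D U ρ p i j) (slab T) := by
  refine ((h.contρ.mul (h.contU i)).mul (h.contU j)).add ?_
  split_ifs
  · exact h.contp.sub contDiffOn_const
  · exact contDiffOn_const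

theorem contDiffOn_kinetic :
    ContDiffOn ℝ 1 (fun z => 1 / 2 * (ρ z * (U 0 z ^ 2 + U 1 z ^ 2))) (slab T) :=
  contDiffOn_const.mul (h.contρ.mul (((h.contU 0).pow 2).add ((h.contU 1).pow 2)))

theorem contDiffOn_energy : ContDiffOn ℝ 1 (energy D U ρ p) (slab T) :=
  h.contDiffOn_kinetic.add (contDiffOn_const.mul (h.contp.sub contDiffOn_const))

theorem contDiffOn_energyFlux (j : Fin 2) : ContDiffOn ℝ 1 (energyFlux D U ρ p j) (slab T) :=
  (h.contDiffOn_kinetic.add (contDiffOn_const.mul h.contp)).mul (h.contU j)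

theorem contDiffOn_entropyDeficit : ContDiffOn ℝ 1 (entropyDeficit D ρ p) (slab T) :=
  h.contρ.mul (contDiff_sq_max.comp_contDiffOn
    (contDiffOn_const.sub (contDiffOn_entropy h.contρ h.contp h.ρ_pos h.p_pos)))

theorem contDiffOn_acousticEnergy : ContDiffOn ℝ 1 (acousticEnergy D U ρ p) (slab T) :=
  h.contDiffOn_kinetic.add (contDiffOn_const.mul
    (((h.contp.sub contDiffOn_const).pow 2).div h.contp fun z hz => (h.p_pos z hz).ne'))

theorem contDiffOn_acousticFlux (j : Fin 2) : ContDiffOn ℝ 1 (acousticFlux D U ρ p j) (slab T) :=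
  (h.contDiffOn_acousticEnergy.add (h.contp.sub contDiffOn_const)).mul (h.contU j)

theorem mass_law {t : ℝ} (ht : t ∈ Ioo 0 T) (x : Plane) :
    dT (fun z => ρ z - D.rhoBar) (t, x) + ∑ j, dX j (fun z => ρ z * U j z) (t, x) = 0 := by
  have hρ := (differentiableAt_of_slab h.contρ ht x).hasFDerivAt
  have hU := fun i => (differentiableAt_of_slab (h.contU i) ht x).hasFDerivAt
  have hm := h.mass t ht x
  simp only [dT, dX, Fin.sum_univ_two, (hρ.sub_const D.rhoBar).fderiv,
    fun j => (hρ.fun_mul (hU j)).fderiv] at hm ⊢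
  simp only [add_apply, smul_apply, smul_eq_mul]
  linear_combination hm

theorem momentum_law {t : ℝ} (ht : t ∈ Ioo 0 T) (x : Plane) (i : Fin 2) :
    dT (fun z => ρ z * U i z) (t, x) + ∑ j, dX j (momentumFlux D U ρ p i j) (t, x)
      = -(D.l * ρ (t, x) * (![-U 1 (t, x), U 0 (t, x)] i)) := by
  have hρ := (differentiableAt_of_slab h.contρ ht x).hasFDerivAt
  have hU := fun i => (differentiableAt_of_slab (h.contU i) ht x).hasFDerivAt
  have hp := ((differentiableAt_of_slab h.contp ht x).hasFDerivAt).sub_const D.pBar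
  have hm := h.mass t ht x
  have hv := h.velocity t ht x i
  have hq : ∀ j, HasFDerivAt (momentumFlux D U ρ p i j)
      (_ + if i = j then fderiv ℝ p (t, x) else 0) (t, x) := fun j => by
    refine ((hρ.fun_mul (hU i)).fun_mul (hU j)).fun_add ?_
    split_ifs
    · exact hp
    · exact hasFDerivAt_const _ _
  have hs : ∑ j, (if i = j then fderiv ℝ p (t, x) else 0) (0, EuclideanSpace.single j 1)
      = dX i p (t, x) := by
    fin_cases i <;> simp [dX]
  simp only [dT, dX, Fin.sum_univ_two, fun j => (hq j).fderiv, (hρ.fun_mul (hU i)).fderiv]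
    at hm hv hs ⊢
  simp only [add_apply, smul_apply, smul_eq_mul]
  linear_combination hv + U i (t, x) * hm + hs

theorem energy_law {t : ℝ} (ht : t ∈ Ioo 0 T) (x : Plane) :
    dT (energy D U ρ p) (t, x) + ∑ j, dX j (energyFlux D U ρ p j) (t, x) = 0 := by
  have hρ := (differentiableAt_of_slab h.contρ ht x).hasFDerivAt
  have hU := fun i => (differentiableAt_of_slab (h.contU i) ht x).hasFDerivAt
  have hp := (differentiableAt_of_slab h.contp ht x).hasFDerivAt
  have hm := h.mass t ht x
  have hv0 := h.velocity t ht x 0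
  have hv1 := h.velocity t ht x 1
  have hpr := h.pressure t ht x
  have hk := (hρ.fun_mul (((hU 0).pow 2).fun_add ((hU 1).pow 2))).const_mul (1 / 2)
  have he : HasFDerivAt (energy D U ρ p) _ (t, x) :=
    hk.fun_add ((hp.sub_const D.pBar).const_mul (1 / (D.γ - 1)))
  have hq : ∀ j, HasFDerivAt (energyFlux D U ρ p j) _ (t, x) := fun j =>
    (hk.fun_add (hp.const_mul (D.γ / (D.γ - 1)))).fun_mul (hU j)
  have hγ : D.γ - 1 ≠ 0 := (sub_pos.2 D.one_lt_γ).ne'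
  have hγ' : D.γ / (D.γ - 1) = 1 + 1 / (D.γ - 1) := by field_simp; ring
  have hγ2 : D.γ * (1 / (D.γ - 1)) = 1 + 1 / (D.γ - 1) := by field_simp; ring
  simp only [dT, dX, Fin.sum_univ_two, he.fderiv, fun j => (hq j).fderiv, Matrix.cons_val_zero,
    Matrix.cons_val_one] at hm hv0 hv1 hpr ⊢
  simp only [add_apply, smul_apply, smul_eq_mul,
    nsmul_eq_mul, hγ']
  push_cast
  linear_combination U 0 (t, x) * hv0 + U 1 (t, x) * hv1
    + 1 / 2 * (U 0 (t, x) ^ 2 + U 1 (t, x) ^ 2) * hm + 1 / (D.γ - 1) * hpr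
    - p (t, x) * (fderiv ℝ (U 0) (t, x) (0, EuclideanSpace.single 0 1)
      + fderiv ℝ (U 1) (t, x) (0, EuclideanSpace.single 1 1)) * hγ2

theorem entropyDeficit_law {t : ℝ} (ht : t ∈ Ioo 0 T) (x : Plane) :
    dT (entropyDeficit D ρ p) (t, x)
      + ∑ j, dX j (fun z => entropyDeficit D ρ p z * U j z) (t, x) = 0 := by
  have hρ := (differentiableAt_of_slab h.contρ ht x).hasFDerivAt
  have hU := fun i => (differentiableAt_of_slab (h.contU i) ht x).hasFDerivAt
  have hS := (differentiableAt_of_slab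
    (contDiffOn_entropy (γ := D.γ) h.contρ h.contp h.ρ_pos h.p_pos) ht x).hasFDerivAt
  have hm := h.mass t ht x
  have hs := h.entropy_transport t ht x
  have hd : HasFDerivAt (entropyDeficit D ρ p) _ (t, x) :=
    hρ.fun_mul ((hasDerivAt_sq_max _).comp_hasFDerivAt (t, x) (hS.const_sub D.SBar))
  simp only [dT, dX, Fin.sum_univ_two, hd.fderiv, fun j => (hd.fun_mul (hU j)).fderiv]
    at hm hs ⊢
  simp only [add_apply, smul_apply, smul_eq_mul,
    neg_apply, entropyDeficit]
  set m := max (D.SBar - entropy D.γ (ρ (t, x)) (p (t, x))) 0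
  linear_combination m ^ 2 * hm - ρ (t, x) * (2 * m) * hs

/-- The background state has constant pressure, so the acoustic energy has a source quadratic in
`p - p̄` only; the Coriolis force does no work. -/
theorem acoustic_law {t : ℝ} (ht : t ∈ Ioo 0 T) (x : Plane) :
    dT (acousticEnergy D U ρ p) (t, x) + ∑ j, dX j (acousticFlux D U ρ p j) (t, x)
      = (D.γ + 1) * (1 / (2 * D.γ) * ((p (t, x) - D.pBar) ^ 2 / p (t, x)))
        * ∑ j, dX j (U j) (t, x) := by
  have hρ := (differentiableAt_of_slab h.contρ ht x).hasFDerivAt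
  have hU := fun i => (differentiableAt_of_slab (h.contU i) ht x).hasFDerivAt
  have hp := (differentiableAt_of_slab h.contp ht x).hasFDerivAt
  have hp0 := (h.p_pos _ (mem_slab (Ioo_subset_Ico_self ht) x)).ne'
  have hm := h.mass t ht x
  have hv0 := h.velocity t ht x 0
  have hv1 := h.velocity t ht x 1
  have hpr := h.pressure t ht x
  have hk := (hρ.fun_mul (((hU 0).pow 2).fun_add ((hU 1).pow 2))).const_mul (1 / 2)
  have he : HasFDerivAt (acousticEnergy D U ρ p) _ (t, x) :=
    hk.fun_add ((((hp.sub_const D.pBar).pow 2).fun_mul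
      ((hasDerivAt_inv hp0).comp_hasFDerivAt (t, x) hp)).const_mul (1 / (2 * D.γ)))
  have hq : ∀ j, HasFDerivAt (acousticFlux D U ρ p j) _ (t, x) := fun j =>
    (he.fun_add (hp.sub_const D.pBar)).fun_mul (hU j)
  have hγ : D.γ ≠ 0 := (zero_lt_one.trans D.one_lt_γ).ne'
  simp only [dT, dX, Fin.sum_univ_two, he.fderiv, fun j => (hq j).fderiv, Matrix.cons_val_zero,
    Matrix.cons_val_one] at hm hv0 hv1 hpr ⊢
  simp only [add_apply, smul_apply, smul_eq_mul,
    nsmul_eq_mul, acousticEnergy, Function.comp]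
  push_cast
  set π := p (t, x) - D.pBar with hπ
  -- energy multipliers: `u`, `|u|²/2`, and the derivative of `(p - p̄)² / (2γp)` with respect to `p`
  linear_combination (norm := skip) U 0 (t, x) * hv0 + U 1 (t, x) * hv1
    + 1 / 2 * (U 0 (t, x) ^ 2 + U 1 (t, x) ^ 2) * hm
    + (π / (D.γ * p (t, x)) - π ^ 2 / (2 * D.γ * p (t, x) ^ 2)) * hpr
  field_simp
  ring

end IsFlow

end Laws

/-! ### The acoustic energy in a backward cone -/

theorem CauchyData.γ_pos (D : CauchyData) : 0 < D.γ := zero_lt_one.trans D.one_lt_γ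

theorem CauchyData.sq_σ (D : CauchyData) :
    D.σ ^ 2 = D.γ * Real.exp D.SBar * D.rhoBar ^ (D.γ - 1) :=
  Real.sq_sqrt (mul_nonneg (mul_nonneg D.γ_pos.le (Real.exp_pos _).le)
    (Real.rpow_nonneg D.rhoBar_pos.le _))

theorem CauchyData.σ_pos (D : CauchyData) : 0 < D.σ :=
  Real.sqrt_pos.2 (mul_pos (mul_pos D.γ_pos (Real.exp_pos _)) (Real.rpow_pos_of_pos D.rhoBar_pos _))

theorem CauchyData.σ_eq (D : CauchyData) : D.σ = Real.sqrt (D.γ * D.pBar / D.rhoBar) := by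
  have h : D.pBar = Real.exp D.SBar * D.rhoBar ^ D.γ :=
    state_equation D.γ D.rhoBar D.pBar D.rhoBar_pos D.pBar_pos
  rw [CauchyData.σ, Real.rpow_sub_one D.rhoBar_pos.ne', h]
  ring_nf

/-- The derivatives are bounded down to `t = 0`, since the flow is `C¹` up to the initial time. -/
theorem exists_bound_fderiv {T τ : ℝ} (hτ : τ < T) {F : ℝ × Plane → ℝ}
    (hF : ContDiffOn ℝ 1 F (slab T)) {K : Set Plane} (hK : IsCompact K) (v : ℝ × Plane) :
    ∃ C, ∀ t ∈ Ioo 0 τ, ∀ x ∈ K, |fderiv ℝ F (t, x) v| ≤ C := by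
  have hc : ContinuousOn (fun z => fderivWithin ℝ F (slab T) z v) (slab T) :=
    (hF.continuousOn_fderivWithin (uniqueDiffOn_slab T) (by norm_num)).clm_apply continuousOn_const
  obtain ⟨C, hC⟩ := ((isCompact_Icc (a := (0 : ℝ)) (b := τ)).prod hK).exists_bound_of_continuousOn
    (hc.mono (prod_mono (Icc_subset_Ico_right hτ) (subset_univ K)))
  refine ⟨C, fun t ht x hx => ?_⟩
  rw [← fderivWithin_of_mem_nhds (slab_mem_nhds ⟨ht.1, ht.2.trans hτ⟩ x)]
  exact hC (t, x) ⟨Ioo_subset_Icc_self ht, hx⟩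

theorem norm_sq_eq (x : Plane) : ‖x‖ ^ 2 = x 0 ^ 2 + x 1 ^ 2 := by
  rw [EuclideanSpace.norm_sq_eq, Fin.sum_univ_two]
  simp

/-- The flux `(η + π) u` of the acoustic energy `η`, in the direction of a vector of length at most
`ℓ`, is at least `-ℓ (|u| + c) η`, where `c = √(γp/ϱ)` is the local sound speed: `|π| |u| ≤ c η` is the
inequality between the arithmetic and geometric means of the two parts of `η`. -/
theorem acoustic_flux_bound {γ r p π a b u v ℓ k η : ℝ} (hγ : 0 < γ) (hr : 0 < r) (hp : 0 < p)
    (hℓ : 0 ≤ ℓ) (hab : a ^ 2 + b ^ 2 ≤ ℓ ^ 2)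
    (hη : η = 1 / 2 * (r * (u ^ 2 + v ^ 2)) + 1 / (2 * γ) * (π ^ 2 / p))
    (hk : Real.sqrt (u ^ 2 + v ^ 2) + Real.sqrt (γ * p / r) ≤ k) :
    -(ℓ * k * η) ≤ a * ((η + π) * u) + b * ((η + π) * v) := by
  set n := Real.sqrt (u ^ 2 + v ^ 2) with hn
  set c := Real.sqrt (γ * p / r) with hc
  have hn2 : n ^ 2 = u ^ 2 + v ^ 2 := Real.sq_sqrt (by positivity)
  have hc2 : c ^ 2 = γ * p / r := Real.sq_sqrt (by positivity)
  have hc0 : 0 < c := Real.sqrt_pos.2 (by positivity)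
  have hn0 : 0 ≤ n := Real.sqrt_nonneg _
  have hη0 : 0 ≤ η := by rw [hη]; positivity
  have hγp : γ * p = c ^ 2 * r := by rw [hc2]; field_simp
  have h1 : n * |π| ≤ c * η := by
    have e : c * η - n * |π| = (c * r * n - |π|) ^ 2 / (2 * c * r) := by
      have e1 : 1 / (2 * γ) * (π ^ 2 / p) = π ^ 2 / (2 * (c ^ 2 * r)) := by
        rw [← hγp]; field_simp
      rw [hη, e1, ← hn2, sub_sq, sq_abs]
      field_simp
      ring
    have : 0 ≤ c * η - n * |π| := by rw [e]; positivity
    linarith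
  have h2 : |a * u + b * v| ≤ ℓ * n := by
    refine abs_le_of_sq_le_sq ?_ (by positivity)
    rw [mul_pow, hn2]
    nlinarith [sq_nonneg (a * v - b * u), mul_le_mul_of_nonneg_right hab
      (by positivity : 0 ≤ u ^ 2 + v ^ 2)]
  have h3 : |(a * u + b * v) * (η + π)| ≤ ℓ * n * (η + |π|) := by
    rw [abs_mul]
    refine mul_le_mul h2 ((abs_add_le _ _).trans (by rw [abs_of_nonneg hη0])) (abs_nonneg _)
      (by positivity)
  have h4 : ℓ * n * (η + |π|) ≤ ℓ * k * η := by
    have : n * η + n * |π| ≤ k * η := by nlinarith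
    nlinarith
  have h5 := neg_abs_le ((a * u + b * v) * (η + π))
  nlinarith

/-- The defining function `(r - k t)² - |x - x₀|²` of the backward cone with base radius `r`,
centre `x₀` and slope `k`; as long as `k t < r`, it is positive exactly inside the cone. -/
def coneFun (x₀ : Plane) (r k : ℝ) (z : ℝ × Plane) : ℝ :=
  (r - k * z.1) ^ 2 - ((z.2 0 - x₀ 0) ^ 2 + (z.2 1 - x₀ 1) ^ 2)

theorem coneFun_eq (x₀ : Plane) (r k t : ℝ) (x : Plane) :
    coneFun x₀ r k (t, x) = (r - k * t) ^ 2 - ‖x - x₀‖ ^ 2 := by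
  rw [norm_sq_eq]
  simp [coneFun]

theorem hasFDerivAt_coord (j : Fin 2) (z : ℝ × Plane) :
    HasFDerivAt (fun z : ℝ × Plane => z.2 j)
      ((EuclideanSpace.proj (𝕜 := ℝ) j).comp (ContinuousLinearMap.snd ℝ ℝ Plane)) z :=
  ((EuclideanSpace.proj (𝕜 := ℝ) j).comp (ContinuousLinearMap.snd ℝ ℝ Plane)).hasFDerivAt

theorem contDiff_coord (j : Fin 2) : ContDiff ℝ 1 fun z : ℝ × Plane => z.2 j :=
  ((EuclideanSpace.proj (𝕜 := ℝ) j).comp (ContinuousLinearMap.snd ℝ ℝ Plane)).contDiff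

/-- The square of the positive part of `coneFun`, a `C¹` weight. -/
def coneWeight (x₀ : Plane) (r k : ℝ) (z : ℝ × Plane) : ℝ := max (coneFun x₀ r k z) 0 ^ 2

theorem contDiff_coneWeight (x₀ : Plane) (r k : ℝ) : ContDiff ℝ 1 (coneWeight x₀ r k) := by
  refine contDiff_sq_max.comp (ContDiff.sub ?_ ?_)
  · fun_prop
  · exact (((contDiff_coord 0).sub contDiff_const).pow 2).add
      (((contDiff_coord 1).sub contDiff_const).pow 2)

theorem fderiv_coneWeight (x₀ : Plane) (r k : ℝ) (z v : ℝ × Plane) :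
    fderiv ℝ (coneWeight x₀ r k) z v = 2 * max (coneFun x₀ r k z) 0 *
      (-(2 * (r - k * z.1) * k * v.1)
        - 2 * ((z.2 0 - x₀ 0) * v.2 0 + (z.2 1 - x₀ 1) * v.2 1)) := by
  have h1 : HasFDerivAt (fun z : ℝ × Plane => (r - k * z.1) ^ 2) _ z :=
    (((ContinuousLinearMap.fst ℝ ℝ Plane).hasFDerivAt.const_mul k).const_sub r).pow 2
  have h2 : HasFDerivAt (coneFun x₀ r k) _ z := h1.fun_sub
    ((((hasFDerivAt_coord 0 z).sub_const (x₀ 0)).pow 2).fun_add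
      (((hasFDerivAt_coord 1 z).sub_const (x₀ 1)).pow 2))
  have h3 : HasFDerivAt (coneWeight x₀ r k) _ z := (hasDerivAt_sq_max _).comp_hasFDerivAt z h2
  rw [h3.fderiv]
  simp only [smul_apply, sub_apply, add_apply, neg_apply, smul_eq_mul, nsmul_eq_mul,
    ContinuousLinearMap.comp_apply, ContinuousLinearMap.coe_fst', ContinuousLinearMap.coe_snd',
    PiLp.proj_apply]
  push_cast
  ring

namespace IsFlow

variable {D : CauchyData} {T : ℝ} {U : Fin 2 → ℝ × Plane → ℝ} {ρ p : ℝ × Plane → ℝ}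

/-- The sum of the flow speed and of the local sound speed. -/
def signalSpeed (D : CauchyData) (U : Fin 2 → ℝ × Plane → ℝ) (ρ p : ℝ × Plane → ℝ)
    (z : ℝ × Plane) : ℝ :=
  Real.sqrt (U 0 z ^ 2 + U 1 z ^ 2) + Real.sqrt (D.γ * p z / ρ z)

/-- The flow is in the background state of rest at the point `z`. -/
def AtRest (D : CauchyData) (U : Fin 2 → ℝ × Plane → ℝ) (ρ p : ℝ × Plane → ℝ)
    (z : ℝ × Plane) : Prop :=
  (∀ j, U j z = 0) ∧ ρ z = D.rhoBar ∧ p z = D.pBar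

theorem signalSpeed_of_atRest {z : ℝ × Plane} (hz : AtRest D U ρ p z) :
    signalSpeed D U ρ p z = D.σ := by
  simp [signalSpeed, hz.1, hz.2.1, hz.2.2, D.σ_eq]

variable (h : IsFlow D T U ρ p)
include h

theorem continuousOn_signalSpeed : ContinuousOn (signalSpeed D U ρ p) (slab T) := by
  have h0 := (h.contU 0).continuousOn
  have h1 := (h.contU 1).continuousOn
  exact ((h0.pow 2).add (h1.pow 2)).sqrt.add
    ((continuousOn_const.mul h.contp.continuousOn).div h.contρ.continuousOn
      fun z hz => (h.ρ_pos z hz).ne').sqrt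

theorem atRest_init {x : Plane} (hx : D.R ≤ ‖x‖) : AtRest D U ρ p (0, x) := by
  have hx' : x ∉ Metric.ball (0 : Plane) D.R := by simpa using hx
  exact ⟨fun j => by rw [h.U_init, D.u0_outside x hx']; rfl, by
    rw [h.ρ_init, D.rho0_outside x hx'], by rw [h.p_init, D.p0_outside x hx']⟩

theorem acousticEnergy_nonneg {z : ℝ × Plane} (hz : z ∈ slab T) : 0 ≤ acousticEnergy D U ρ p z := by
  have h1 := h.ρ_pos z hz
  have h2 := h.p_pos z hz
  have h3 := D.γ_pos
  unfold acousticEnergy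
  positivity

/-- Energy estimate in a backward cone which initially lies in the region at rest, and whose slope
is at least the signal speed: the weighted acoustic energy vanishes. -/
theorem coneWeight_mul_acousticEnergy_eq_zero {x₀ : Plane} {r k τ : ℝ} (hk : 0 < k) (hτ : τ < T)
    (hr₀ : 0 ≤ r) (hr : k * τ < r) (hinit : ∀ x, ‖x - x₀‖ ≤ r → D.R ≤ ‖x‖)
    (hspeed : ∀ t ∈ Ioo 0 τ, ∀ x, ‖x - x₀‖ ≤ r - k * t → signalSpeed D U ρ p (t, x) ≤ k) :
    ∀ t ∈ Ico 0 τ, ∀ x, coneWeight x₀ r k (t, x) * acousticEnergy D U ρ p (t, x) = 0 := by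
  have hsub : slab τ ⊆ slab T := slab_mono hτ.le
  have hpos : ∀ t ∈ Ico 0 τ, 0 < r - k * t ∧ r - k * t ≤ r := fun t ht =>
    ⟨by nlinarith [ht.2], by nlinarith [ht.1]⟩
  have hK : IsCompact (Metric.closedBall x₀ r) := isCompact_closedBall x₀ r
  have hout : ∀ t ∈ Ico 0 τ, ∀ x, r - k * t ≤ ‖x - x₀‖ → max (coneFun x₀ r k (t, x)) 0 = 0 := by
    intro t ht x hx
    rw [coneFun_eq]
    refine max_eq_right ?_
    nlinarith [(hpos t ht).1]
  have hsupp : ∀ t ∈ Ico 0 τ, ∀ x ∉ Metric.closedBall x₀ r, coneWeight x₀ r k (t, x) = 0 := by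
    intro t ht x hx
    rw [Metric.mem_closedBall, dist_eq_norm, not_le] at hx
    rw [coneWeight, hout t ht x (by linarith [(hpos t ht).2])]
    norm_num
  -- bounds for `div u` in the cone
  obtain ⟨C₀, hC₀⟩ := exists_bound_fderiv hτ (h.contU 0) hK (0, EuclideanSpace.single 0 1)
  obtain ⟨C₁, hC₁⟩ := exists_bound_fderiv hτ (h.contU 1) hK (0, EuclideanSpace.single 1 1)
  obtain ⟨hcont, hder⟩ := weighted_balance_law
    (s := fun z => (D.γ + 1) * (1 / (2 * D.γ) * ((p z - D.pBar) ^ 2 / p z)) * ∑ j, dX j (U j) z)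
    hK (contDiff_coneWeight x₀ r k)
    (h.contDiffOn_acousticEnergy.mono hsub) (fun j => (h.contDiffOn_acousticFlux j).mono hsub)
    (fun t ht x hx => Or.inl (hsupp t ht x hx))
    (fun t ht x => h.acoustic_law ⟨ht.1, ht.2.trans hτ⟩ x)
  have hcd : ContDiffOn ℝ 1 (fun z => coneWeight x₀ r k z * acousticEnergy D U ρ p z) (slab τ) :=
    (contDiff_coneWeight x₀ r k).contDiffOn.mul (h.contDiffOn_acousticEnergy.mono hsub)
  have hslice : ∀ t ∈ Ico 0 τ,
      Continuous fun x => coneWeight x₀ r k (t, x) * acousticEnergy D U ρ p (t, x) := fun t ht =>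
    (contDiff_slice hcd ht).continuous
  have hint : ∀ t ∈ Ico 0 τ,
      Integrable fun x => coneWeight x₀ r k (t, x) * acousticEnergy D U ρ p (t, x) := fun t ht =>
    (hslice t ht).integrable_of_hasCompactSupport
      (HasCompactSupport.intro hK fun x hx => by rw [hsupp t ht x hx, zero_mul])
  have hnn : ∀ t ∈ Ico 0 τ, ∀ x,
      0 ≤ coneWeight x₀ r k (t, x) * acousticEnergy D U ρ p (t, x) := fun t ht x =>
    mul_nonneg (sq_nonneg _) (h.acousticEnergy_nonneg (hsub (mem_slab ht x)))
  have hzero := eq_zero_of_deriv_le_mul (C := (D.γ + 1) * (C₀ + C₁)) hcont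
    (fun t ht => (hder t ht).2) ?_ ?_ fun t ht => integral_nonneg (hnn t ht)
  · intro t ht x
    have h1 := (integral_eq_zero_iff_of_nonneg (hnn t ht) (hint t ht)).1 (hzero t ht)
    exact congrFun ((hslice t ht).ae_eq_iff_eq volume continuous_const |>.1 h1) x
  · intro t ht
    have ht' := Ioo_subset_Ico_self ht
    rw [← integral_const_mul]
    refine integral_mono (hder t ht).1 ((hint t ht').const_mul _) fun x => ?_
    simp only [dT, dX, fderiv_coneWeight, Fin.sum_univ_two]
    rcases le_or_gt (r - k * t) ‖x - x₀‖ with hx | hx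
    · simp [coneWeight, hout t ht' x hx]
    · have hz := hsub (mem_slab ht' x)
      have hρ := h.ρ_pos _ hz
      have hp := h.p_pos _ hz
      have hγ := D.γ_pos
      have hη := h.acousticEnergy_nonneg hz
      have hxK : x ∈ Metric.closedBall x₀ r := by
        rw [Metric.mem_closedBall, dist_eq_norm]
        linarith [(hpos t ht').2]
      have hdiv : fderiv ℝ (U 0) (t, x) (0, EuclideanSpace.single 0 1)
          + fderiv ℝ (U 1) (t, x) (0, EuclideanSpace.single 1 1) ≤ C₀ + C₁ :=
        add_le_add ((le_abs_self _).trans (hC₀ t ht x hxK)) ((le_abs_self _).trans (hC₁ t ht x hxK))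
      have hC : 0 ≤ C₀ + C₁ := add_nonneg ((abs_nonneg _).trans (hC₀ t ht x hxK))
        ((abs_nonneg _).trans (hC₁ t ht x hxK))
      have hflux := acoustic_flux_bound (a := x 0 - x₀ 0) (b := x 1 - x₀ 1)
        (π := p (t, x) - D.pBar) hγ hρ hp (hpos t ht').1.le
        (by
          have := norm_sq_eq (x - x₀)
          simp only [PiLp.sub_apply] at this
          nlinarith [norm_nonneg (x - x₀)])
        (rfl : acousticEnergy D U ρ p (t, x) = _) (hspeed t ht x hx.le)
      have hpot : 1 / (2 * D.γ) * ((p (t, x) - D.pBar) ^ 2 / p (t, x))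
          ≤ acousticEnergy D U ρ p (t, x) := by
        unfold acousticEnergy
        linarith [show 0 ≤ 1 / 2 * (ρ (t, x) * (U 0 (t, x) ^ 2 + U 1 (t, x) ^ 2)) by positivity]
      have hpot0 : 0 ≤ 1 / (2 * D.γ) * ((p (t, x) - D.pBar) ^ 2 / p (t, x)) := by positivity
      have hsrc : 1 / (2 * D.γ) * ((p (t, x) - D.pBar) ^ 2 / p (t, x))
          * (fderiv ℝ (U 0) (t, x) (0, EuclideanSpace.single 0 1)
            + fderiv ℝ (U 1) (t, x) (0, EuclideanSpace.single 1 1))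
          ≤ acousticEnergy D U ρ p (t, x) * (C₀ + C₁) :=
        (mul_le_mul_of_nonneg_left hdiv hpot0).trans (mul_le_mul_of_nonneg_right hpot hC)
      simp only [coneWeight, acousticFlux]
      have hm : 0 ≤ max (coneFun x₀ r k (t, x)) 0 := le_max_right _ _
      set m := max (coneFun x₀ r k (t, x)) 0
      have e1 := mul_le_mul_of_nonneg_left hsrc
        (mul_nonneg (sq_nonneg m) (by linarith : 0 ≤ D.γ + 1))
      have e2 := mul_le_mul_of_nonneg_left hflux (mul_nonneg zero_le_four hm)
      simp [-one_div, -mul_inv_rev]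
      linear_combination e1 + e2
  · refine integral_eq_zero_of_ae (Eventually.of_forall fun x => ?_)
    simp only [Pi.zero_apply]
    rcases le_or_gt ‖x - x₀‖ r with hx | hx
    · obtain ⟨hU, -, hp⟩ := h.atRest_init (hinit x hx)
      simp [acousticEnergy, hU, hp]
    · have : coneFun x₀ r k (0, x) ≤ 0 := by
        rw [coneFun_eq]
        nlinarith [norm_nonneg (x - x₀), hr, hx]
      simp [coneWeight, max_eq_right this]

end IsFlow

/-! ### Finite speed of propagation -/

namespace IsFlow

variable {D : CauchyData} {T : ℝ} {U : Fin 2 → ℝ × Plane → ℝ} {ρ p : ℝ × Plane → ℝ}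
variable (h : IsFlow D T U ρ p)
include h

/-- Under the hypotheses of the energy estimate, the flow is at rest in the open cone. -/
theorem atRest_of_lt_cone {x₀ : Plane} {r k τ : ℝ} (hk : 0 < k) (hτ : τ < T)
    (hr₀ : 0 ≤ r) (hr : k * τ < r) (hinit : ∀ x, ‖x - x₀‖ ≤ r → D.R ≤ ‖x‖)
    (hspeed : ∀ t ∈ Ioo 0 τ, ∀ x, ‖x - x₀‖ ≤ r - k * t → signalSpeed D U ρ p (t, x) ≤ k) :
    ∀ t ∈ Ico 0 τ, ∀ x, ‖x - x₀‖ < r - k * t → AtRest D U ρ p (t, x) := by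
  have hE := h.coneWeight_mul_acousticEnergy_eq_zero hk hτ hr₀ hr hinit hspeed
  have hup : ∀ t ∈ Ico 0 τ, ∀ x, ‖x - x₀‖ < r - k * t →
      (∀ j, U j (t, x) = 0) ∧ p (t, x) = D.pBar := by
    intro t ht x hx
    have hz : (t, x) ∈ slab T := slab_mono hτ.le (mem_slab ht x)
    have hρ := h.ρ_pos _ hz
    have hp := h.p_pos _ hz
    have hγ := D.γ_pos
    have hpos : 0 < coneFun x₀ r k (t, x) := by
      rw [coneFun_eq]
      nlinarith [norm_nonneg (x - x₀)]
    have hw : coneWeight x₀ r k (t, x) ≠ 0 := by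
      rw [coneWeight, max_eq_left hpos.le]
      positivity
    have h0 := (mul_eq_zero.1 (hE t ht x)).resolve_left hw
    unfold acousticEnergy at h0
    obtain ⟨h1, h2⟩ := (add_eq_zero_iff_of_nonneg (by positivity) (by positivity)).1 h0
    have h3 : U 0 (t, x) ^ 2 + U 1 (t, x) ^ 2 = 0 := by
      simpa [hρ.ne'] using h1
    have h4 : p (t, x) - D.pBar = 0 := by
      simpa [hp.ne', hγ.ne'] using h2
    obtain ⟨h5, h6⟩ := (add_eq_zero_iff_of_nonneg (sq_nonneg _) (sq_nonneg _)).1 h3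
    refine ⟨fun j => ?_, sub_eq_zero.1 h4⟩
    fin_cases j
    · exact pow_eq_zero_iff two_ne_zero |>.1 h5
    · exact pow_eq_zero_iff two_ne_zero |>.1 h6
  intro t ht x hx
  refine ⟨(hup t ht x hx).1, ?_, (hup t ht x hx).2⟩
  -- the density is constant in time along the segment inside the cone, since `div (ϱu) = 0` there
  obtain ⟨τ', htτ', hτ'τ, hxτ'⟩ : ∃ τ', t < τ' ∧ τ' ≤ τ ∧ ∀ s < τ', ‖x - x₀‖ < r - k * s := by
    refine ⟨min τ ((r - ‖x - x₀‖) / k), lt_min ht.2 ?_, min_le_left _ _, fun s hs => ?_⟩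
    · rw [lt_div_iff₀ hk]
      linarith
    · have := (lt_div_iff₀ hk).1 (hs.trans_le (min_le_right _ _))
      linarith
  have hτ'T : τ' < T := hτ'τ.trans_lt hτ
  have hopen : IsOpen {z : ℝ × Plane | z.1 ∈ Ioo 0 τ ∧ ‖z.2 - x₀‖ < r - k * z.1} :=
    (isOpen_Ioo.preimage continuous_fst).inter
      (isOpen_lt (f := fun z : ℝ × Plane => ‖z.2 - x₀‖) (g := fun z => r - k * z.1)
        (by fun_prop) (by fun_prop))
  have hder : ∀ s ∈ Ioo 0 τ', HasDerivAt (fun s => ρ (s, x)) 0 s := by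
    intro s hs
    have hsT : s ∈ Ioo 0 T := ⟨hs.1, hs.2.trans hτ'T⟩
    have hsτ : s ∈ Ioo 0 τ := ⟨hs.1, hs.2.trans_le hτ'τ⟩
    have hm := h.mass s hsT x
    have hU : ∀ j, U j (s, x) = 0 := (hup s (Ioo_subset_Ico_self hsτ) x (hxτ' s hs.2)).1
    have hdU : ∀ j, dX j (U j) (s, x) = 0 := by
      intro j
      have he : U j =ᶠ[𝓝 (s, x)] fun _ => 0 := by
        filter_upwards [hopen.mem_nhds ⟨hsτ, hxτ' s hs.2⟩] with z hz
        exact (hup z.1 (Ioo_subset_Ico_self hz.1) z.2 hz.2).1 j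
      rw [dX, he.fderiv_eq]
      simp
    have h1 := hasDerivAt_time (differentiableAt_of_slab h.contρ hsT x)
    have h2 : dT ρ (s, x) = 0 := by simpa [hU, hdU] using hm
    rwa [h2] at h1
  have hc : ContinuousOn (fun s => ρ (s, x)) (Ico 0 τ') :=
    h.contρ.continuousOn.comp (by fun_prop) fun s hs => mem_slab ⟨hs.1, hs.2.trans hτ'T⟩ x
  have hx0 : ‖x - x₀‖ ≤ r := by nlinarith [ht.1]
  have h0 : ρ (0, x) = D.rhoBar := (h.atRest_init (hinit x hx0)).2.1
  exact eq_of_hasDerivAt_eq hc continuousOn_const hder (fun s _ => hasDerivAt_const s D.rhoBar) h0 t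
    ⟨ht.1, htτ'⟩

/-- In a backward cone which initially lies in the region at rest, and whose slope exceeds the sound
speed of the background, the signal speed stays below the slope: at the first time at which it
reaches the slope the flow would still be at rest, by the energy estimate. -/
theorem signalSpeed_lt_of_mem_cone {x₀ : Plane} {r k τ : ℝ} (hk : D.σ < k) (hτ : τ < T)
    (hr₀ : 0 ≤ r) (hr : k * τ < r) (hinit : ∀ x, ‖x - x₀‖ ≤ r → D.R ≤ ‖x‖) :
    ∀ t ∈ Icc 0 τ, ∀ x, ‖x - x₀‖ ≤ r - k * t → signalSpeed D U ρ p (t, x) < k := by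
  by_contra! hcon
  obtain ⟨t₁, ht₁, x₁, hx₁, hs₁⟩ := hcon
  have hk0 : 0 < k := D.σ_pos.trans hk
  set C : Set (ℝ × Plane) :=
    (Icc 0 τ ×ˢ Metric.closedBall x₀ r) ∩ {z | ‖z.2 - x₀‖ ≤ r - k * z.1} with hC
  have hCc : IsCompact C := (isCompact_Icc.prod (isCompact_closedBall x₀ r)).inter_right
    (isClosed_le (by fun_prop) (by fun_prop))
  have hCs : C ⊆ slab T := fun z hz => ⟨⟨hz.1.1.1, hz.1.1.2.trans_lt hτ⟩, mem_univ _⟩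
  have hmem : ∀ t ∈ Icc 0 τ, ∀ x, ‖x - x₀‖ ≤ r - k * t → (t, x) ∈ C := fun t ht x hx =>
    ⟨⟨ht, by rw [Metric.mem_closedBall, dist_eq_norm]; nlinarith [ht.1]⟩, hx⟩
  have hB : IsCompact (C ∩ signalSpeed D U ρ p ⁻¹' Ici k) :=
    hCc.of_isClosed_subset ((h.continuousOn_signalSpeed.mono hCs).preimage_isClosed_of_isClosed
      hCc.isClosed isClosed_Ici) inter_subset_left
  obtain ⟨⟨t, x⟩, ⟨hzC, hzk⟩, hmin⟩ := hB.exists_isMinOn ⟨(t₁, x₁), hmem t₁ ht₁ x₁ hx₁, hs₁⟩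
    continuous_fst.continuousOn
  have ht : t ∈ Icc 0 τ := hzC.1.1
  have hx : ‖x - x₀‖ ≤ r - k * t := hzC.2
  have htT : t < T := ht.2.trans_lt hτ
  have hrest : AtRest D U ρ p (t, x) := by
    -- `t` is the first time at which the slope is reached
    rcases ht.1.eq_or_lt with h0 | h0
    · subst h0
      exact h.atRest_init (hinit x (by linarith))
    · have hcone := h.atRest_of_lt_cone hk0 htT hr₀ (by nlinarith [ht.2]) hinit (by
        intro s hs y hy
        by_contra! hlt
        have h1 : t ≤ s :=
          hmin (a := (s, y)) ⟨hmem s ⟨hs.1.le, hs.2.le.trans ht.2⟩ y hy, hlt.le⟩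
        exact absurd hs.2 (not_lt.2 h1))
      have hlim : ∀ F : ℝ × Plane → ℝ, ContDiffOn ℝ 1 F (slab T) → ∀ c,
          (∀ s ∈ Ico 0 t, F (s, x) = c) → F (t, x) = c := by
        intro F hF c hc
        have h1 : ContinuousAt (fun s => F (s, x)) t :=
          ((hF.contDiffAt (slab_mem_nhds ⟨h0, htT⟩ x)).continuousAt).comp
            (f := fun s => (s, x)) (by fun_prop)
        have h2 : Tendsto (fun s => F (s, x)) (𝓝[<] t) (𝓝 (F (t, x))) :=
          h1.tendsto.mono_left nhdsWithin_le_nhds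
        refine tendsto_nhds_unique (h2.congr' ?_) tendsto_const_nhds
        filter_upwards [Ioo_mem_nhdsLT h0] with s hs
        exact hc s (Ioo_subset_Ico_self hs)
      have hcone' : ∀ s ∈ Ico 0 t, AtRest D U ρ p (s, x) := fun s hs =>
        hcone s hs x (by nlinarith [hs.2])
      exact ⟨fun j => hlim _ (h.contU j) _ fun s hs => (hcone' s hs).1 j,
        hlim _ h.contρ _ fun s hs => (hcone' s hs).2.1,
        hlim _ h.contp _ fun s hs => (hcone' s hs).2.2⟩
  have h1 := signalSpeed_of_atRest hrest
  have h2 : k ≤ signalSpeed D U ρ p (t, x) := hzk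
  linarith

/-- Finite speed of propagation: outside the disc of radius `R + σ t` the flow stays at rest. -/
theorem atRest_of_radius_le {t : ℝ} (ht : t ∈ Ico 0 T) {x : Plane} (hx : D.radius t ≤ ‖x‖) :
    AtRest D U ρ p (t, x) := by
  have hopen : ∀ x, D.radius t < ‖x‖ → AtRest D U ρ p (t, x) := by
    intro x hx
    rw [CauchyData.radius] at hx
    obtain ⟨τ, hxτ, htτ, hτT⟩ : ∃ τ, D.R + D.σ * τ < ‖x‖ ∧ τ ∈ Ioo t T := by
      have h1 : ∀ᶠ τ in 𝓝[>] t, D.R + D.σ * τ < ‖x‖ :=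
        ((by fun_prop : Continuous fun τ => D.R + D.σ * τ).continuousAt.eventually_lt_const
          hx).filter_mono nhdsWithin_le_nhds
      exact (h1.and (Ioo_mem_nhdsGT ht.2)).exists
    have hτ0 : 0 < τ := ht.1.trans_lt htτ
    obtain ⟨k, hσk, hkx⟩ := exists_between
      (show D.σ < (‖x‖ - D.R) / τ by rw [lt_div_iff₀ hτ0]; linarith)
    have hk0 : 0 < k := D.σ_pos.trans hσk
    rw [lt_div_iff₀ hτ0] at hkx
    have hinit : ∀ y, ‖y - x‖ ≤ ‖x‖ - D.R → D.R ≤ ‖y‖ := by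
      intro y hy
      have := norm_sub_norm_le x y
      rw [norm_sub_rev] at this
      linarith
    have hr₀ : 0 ≤ ‖x‖ - D.R := by nlinarith
    have hspeed := h.signalSpeed_lt_of_mem_cone hσk hτT hr₀ hkx hinit
    refine h.atRest_of_lt_cone hk0 hτT hr₀ hkx hinit
      (fun s hs y hy => (hspeed s (Ioo_subset_Icc_self hs) y hy).le) t ⟨ht.1, htτ⟩ x ?_
    rw [sub_self, norm_zero]
    nlinarith
  have hrad : 0 < D.radius t := by
    rw [CauchyData.radius]
    nlinarith [D.R_pos, D.σ_pos, ht.1]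
  have hcl : x ∈ closure {y : Plane | D.radius t < ‖y‖} := by
    have : {y : Plane | D.radius t < ‖y‖} = (Metric.closedBall (0 : Plane) (D.radius t))ᶜ := by
      ext y; simp
    rw [this, closure_compl, interior_closedBall _ hrad.ne']
    simpa using hx
  have hlim : ∀ F : ℝ × Plane → ℝ, ContDiffOn ℝ 1 F (slab T) → ∀ c,
      (∀ y, D.radius t < ‖y‖ → F (t, y) = c) → F (t, x) = c := by
    intro F hF c hc
    have hclosed : IsClosed {y | F (t, y) = c} :=
      isClosed_eq (contDiff_slice hF ht).continuous continuous_const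
    exact closure_minimal (fun y hy => hc y hy) hclosed hcl
  exact ⟨fun j => hlim _ (h.contU j) _ fun y hy => (hopen y hy).1 j,
    hlim _ h.contρ _ fun y hy => (hopen y hy).2.1,
    hlim _ h.contp _ fun y hy => (hopen y hy).2.2⟩

end IsFlow

/-! ### Mass, energy, momentum and centre of mass -/

theorem CauchyData.radius_pos (D : CauchyData) {t : ℝ} (ht : 0 ≤ t) : 0 < D.radius t := by
  rw [CauchyData.radius]
  nlinarith [D.R_pos, D.σ_pos]

theorem CauchyData.radius_mono (D : CauchyData) {s t : ℝ} (hst : s ≤ t) :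
    D.radius s ≤ D.radius t := by
  rw [CauchyData.radius, CauchyData.radius]
  nlinarith [D.σ_pos]

theorem CauchyData.radius_zero (D : CauchyData) : D.radius 0 = D.R := by simp [CauchyData.radius]

theorem CauchyData.hasDerivAt_radius (D : CauchyData) (t : ℝ) : HasDerivAt D.radius D.σ t := by
  have := ((hasDerivAt_id t).const_mul D.σ).const_add D.R
  rwa [mul_one] at this

theorem CauchyData.continuous_radius (D : CauchyData) : Continuous D.radius :=
  continuous_iff_continuousAt.2 fun t => (D.hasDerivAt_radius t).continuousAt

/-- The integral over the plane of a function on space-time. -/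
def total (F : ℝ × Plane → ℝ) (t : ℝ) : ℝ := ∫ x, F (t, x)

theorem dT_coord (j : Fin 2) (z : ℝ × Plane) : dT (fun z => z.2 j) z = 0 := by
  rw [dT, (hasFDerivAt_coord j z).fderiv]
  simp

theorem dX_coord (i j : Fin 2) (z : ℝ × Plane) :
    dX i (fun z => z.2 j) z = if j = i then 1 else 0 := by
  rw [dX, (hasFDerivAt_coord j z).fderiv]
  simp

theorem continuous_slice {T : ℝ} {F : ℝ × Plane → ℝ} (hF : ContinuousOn F (slab T)) {t : ℝ}
    (ht : t ∈ Ico 0 T) : Continuous fun x => F (t, x) :=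
  hF.comp_continuous (by fun_prop) fun x => mem_slab ht x

namespace IsFlow

variable {D : CauchyData} {T : ℝ} {U : Fin 2 → ℝ × Plane → ℝ} {ρ p : ℝ × Plane → ℝ}

/-- A function of space-time which vanishes wherever the flow is at rest. -/
def VanishesAtRest (D : CauchyData) (T : ℝ) (U : Fin 2 → ℝ × Plane → ℝ) (ρ p F : ℝ × Plane → ℝ) :
    Prop :=
  ∀ z ∈ slab T, AtRest D U ρ p z → F z = 0

theorem vanishes_density : VanishesAtRest D T U ρ p fun z => ρ z - D.rhoBar :=
  fun _ _ hz => by simp [hz.2.1]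

theorem vanishes_massFlux (j : Fin 2) : VanishesAtRest D T U ρ p fun z => ρ z * U j z :=
  fun _ _ hz => by simp [hz.1 j]

theorem vanishes_momentumFlux (i j : Fin 2) :
    VanishesAtRest D T U ρ p (momentumFlux D U ρ p i j) :=
  fun _ _ hz => by simp [momentumFlux, hz.1 j, hz.2.2]

theorem vanishes_energy : VanishesAtRest D T U ρ p (energy D U ρ p) :=
  fun _ _ hz => by simp [energy, hz.1, hz.2.2]

theorem vanishes_kinetic :
    VanishesAtRest D T U ρ p fun z => 1 / 2 * (ρ z * (U 0 z ^ 2 + U 1 z ^ 2)) :=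
  fun _ _ hz => by simp [hz.1]

theorem vanishes_pressure : VanishesAtRest D T U ρ p fun z => p z - D.pBar :=
  fun _ _ hz => by simp [hz.2.2]

theorem vanishes_entropyDeficit : VanishesAtRest D T U ρ p (entropyDeficit D ρ p) :=
  fun _ _ hz => by simp [entropyDeficit, hz.2.1, hz.2.2, CauchyData.SBar]

variable (h : IsFlow D T U ρ p)
include h

theorem eq_zero_of_radius_le {F : ℝ × Plane → ℝ} (hF : VanishesAtRest D T U ρ p F) {t : ℝ}
    (ht : t ∈ Ico 0 T) {x : Plane} (hx : D.radius t ≤ ‖x‖) : F (t, x) = 0 :=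
  hF _ (mem_slab ht x) (h.atRest_of_radius_le ht hx)

theorem eq_zero_of_notMem {F : ℝ × Plane → ℝ} (hF : VanishesAtRest D T U ρ p F) {t : ℝ}
    (ht : t ∈ Ico 0 T) {x : Plane} (hx : x ∉ Metric.closedBall (0 : Plane) (D.radius T)) :
    F (t, x) = 0 := by
  rw [Metric.mem_closedBall, dist_zero_right, not_le] at hx
  exact h.eq_zero_of_radius_le hF ht ((D.radius_mono ht.2.le).trans hx.le)

theorem integrable_slice {F : ℝ × Plane → ℝ} (hF : ContinuousOn F (slab T))
    (hF0 : VanishesAtRest D T U ρ p F) {t : ℝ} (ht : t ∈ Ico 0 T) :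
    Integrable fun x => F (t, x) :=
  (continuous_slice hF ht).integrable_of_hasCompactSupport
    (HasCompactSupport.intro (isCompact_closedBall 0 (D.radius T))
      fun _ hx => h.eq_zero_of_notMem hF0 ht hx)

theorem setIntegral_disc {F : ℝ × Plane → ℝ} (hF : VanishesAtRest D T U ρ p F) {t : ℝ}
    (ht : t ∈ Ico 0 T) : ∫ x in D.disc t, F (t, x) = total F t :=
  setIntegral_eq_integral_of_forall_compl_eq_zero fun x hx =>
    h.eq_zero_of_radius_le hF ht (by simpa [CauchyData.disc] using hx)

theorem total_law {f s : ℝ × Plane → ℝ} {q : Fin 2 → ℝ × Plane → ℝ}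
    (hf : ContDiffOn ℝ 1 f (slab T)) (hq : ∀ j, ContDiffOn ℝ 1 (q j) (slab T))
    (hf0 : VanishesAtRest D T U ρ p f) (hq0 : ∀ j, VanishesAtRest D T U ρ p (q j))
    (hlaw : ∀ t ∈ Ioo 0 T, ∀ x, dT f (t, x) + ∑ j, dX j (q j) (t, x) = s (t, x)) :
    ContinuousOn (total f) (Ico 0 T) ∧ ∀ t ∈ Ioo 0 T, HasDerivAt (total f) (total s t) t := by
  obtain ⟨h1, h2⟩ := balance_law (isCompact_closedBall 0 (D.radius T)) hf hq
    (fun t ht x hx => h.eq_zero_of_notMem hf0 ht hx)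
    (fun j t ht x hx => h.eq_zero_of_notMem (hq0 j) ht hx) hlaw
  exact ⟨h1, fun t ht => (h2 t ht).2⟩

/-- The first moments in `x_i` of a balance law. -/
theorem total_coord_mul_law (i : Fin 2) {f s : ℝ × Plane → ℝ} {q : Fin 2 → ℝ × Plane → ℝ}
    (hf : ContDiffOn ℝ 1 f (slab T)) (hq : ∀ j, ContDiffOn ℝ 1 (q j) (slab T))
    (hf0 : VanishesAtRest D T U ρ p f) (hq0 : ∀ j, VanishesAtRest D T U ρ p (q j))
    (hlaw : ∀ t ∈ Ioo 0 T, ∀ x, dT f (t, x) + ∑ j, dX j (q j) (t, x) = s (t, x)) :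
    ContinuousOn (total fun z => z.2 i * f z) (Ico 0 T) ∧ ∀ t ∈ Ioo 0 T,
      HasDerivAt (total fun z => z.2 i * f z) (total (fun z => z.2 i * s z + q i z) t) t := by
  obtain ⟨h1, h2⟩ := weighted_balance_law (isCompact_closedBall 0 (D.radius T)) (contDiff_coord i)
    hf hq (fun t ht x hx => Or.inr ⟨h.eq_zero_of_notMem hf0 ht hx,
      fun j => h.eq_zero_of_notMem (hq0 j) ht hx⟩) hlaw
  refine ⟨h1, fun t ht => ?_⟩
  have := (h2 t ht).2
  simp only [dT_coord, dX_coord] at this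
  refine HasDerivAt.congr_deriv (f := total fun z => z.2 i * f z) this ?_
  simp [total]

theorem total_density {t : ℝ} (ht : t ∈ Ico 0 T) :
    total (fun z => ρ z - D.rhoBar) t = D.m := by
  have h0 : (0 : ℝ) ∈ Ico 0 T := ⟨le_rfl, ht.1.trans_lt ht.2⟩
  obtain ⟨h1, h2⟩ := h.total_law (s := fun _ => 0) (h.contρ.sub contDiffOn_const)
    h.contDiffOn_massFlux vanishes_density vanishes_massFlux fun t ht x => h.mass_law ht x
  refine eq_of_hasDerivAt_eq h1 continuousOn_const h2 (fun t _ => ?_) ?_ t ht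
  · simpa [total] using hasDerivAt_const t D.m
  · rw [← h.setIntegral_disc vanishes_density h0, CauchyData.disc, D.radius_zero]
    simp only [h.ρ_init, CauchyData.m]

theorem total_energy {t : ℝ} (ht : t ∈ Ico 0 T) : total (energy D U ρ p) t = D.e := by
  have h0 : (0 : ℝ) ∈ Ico 0 T := ⟨le_rfl, ht.1.trans_lt ht.2⟩
  obtain ⟨h1, h2⟩ := h.total_law (s := fun _ => 0) h.contDiffOn_energy h.contDiffOn_energyFlux
    vanishes_energy (fun j _ _ hz => by simp [energyFlux, hz.1 j])
    fun t ht x => h.energy_law ht x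
  refine eq_of_hasDerivAt_eq h1 continuousOn_const h2 (fun t _ => ?_) ?_ t ht
  · simpa [total] using hasDerivAt_const t D.e
  · have hk : Continuous fun x => 1 / 2 * (D.rho0 x * ‖D.u0 x‖ ^ 2) := by
      have := D.contDiff_rho0.continuous
      have := D.contDiff_u0.continuous
      fun_prop
    have hp : Continuous fun x => 1 / (D.γ - 1) * (D.p0 x - D.pBar) := by
      have := D.contDiff_p0.continuous
      fun_prop
    rw [← h.setIntegral_disc vanishes_energy h0, CauchyData.disc, D.radius_zero]
    simp only [energy, h.ρ_init, h.U_init, h.p_init, ← norm_sq_eq]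
    rw [integral_add (integrableOn_ball hk 0 D.R) (integrableOn_ball hp 0 D.R),
      integral_const_mul, integral_const_mul]
    rfl

theorem total_momentum_law (i : Fin 2) : ContinuousOn (total fun z => ρ z * U i z) (Ico 0 T) ∧
    ∀ t ∈ Ioo 0 T, HasDerivAt (total fun z => ρ z * U i z)
      (total (fun z => -(D.l * ρ z * (![-U 1 z, U 0 z] i))) t) t :=
  h.total_law (h.contDiffOn_massFlux i) (h.contDiffOn_momentumFlux i) (vanishes_massFlux i)
    (vanishes_momentumFlux i) fun _ ht x => h.momentum_law ht x i

theorem total_momentum_init (hT : 0 < T) (i : Fin 2) :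
    total (fun z => ρ z * U i z) 0 = D.I0 i := by
  rw [← h.setIntegral_disc (vanishes_massFlux i) ⟨le_rfl, hT⟩, CauchyData.disc, D.radius_zero]
  simp only [h.ρ_init, h.U_init, CauchyData.I0]

/-- The total momentum rotates with angular velocity `-l`. -/
theorem total_momentum {t : ℝ} (ht : t ∈ Ico 0 T) :
    total (fun z => ρ z * U 0 z) t = D.I1 t ∧ total (fun z => ρ z * U 1 z) t = D.I2 t := by
  have hT : 0 < T := ht.1.trans_lt ht.2
  obtain ⟨c0, d0⟩ := h.total_momentum_law 0
  obtain ⟨c1, d1⟩ := h.total_momentum_law 1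
  have i0 := h.total_momentum_init hT 0
  have i1 := h.total_momentum_init hT 1
  have e0 : ∀ t, total (fun z => -(D.l * ρ z * (![-U 1 z, U 0 z] 0))) t
      = D.l * total (fun z => ρ z * U 1 z) t := by
    intro t
    rw [total, total, ← integral_const_mul]
    congr 1 with x
    simp
    ring
  have e1 : ∀ t, total (fun z => -(D.l * ρ z * (![-U 1 z, U 0 z] 1))) t
      = -(D.l * total (fun z => ρ z * U 0 z) t) := by
    intro t
    rw [total, total, ← integral_const_mul, ← integral_neg]
    congr 1 with x
    simp
    ring
  simp only [e0] at d0
  simp only [e1] at d1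
  set a := total fun z => ρ z * U 0 z
  set b := total fun z => ρ z * U 1 z
  have hcos : ∀ t, HasDerivAt (fun t => Real.cos (D.l * t)) (-Real.sin (D.l * t) * D.l) t :=
    fun t => by simpa using ((hasDerivAt_id t).const_mul D.l).cos
  have hsin : ∀ t, HasDerivAt (fun t => Real.sin (D.l * t)) (Real.cos (D.l * t) * D.l) t :=
    fun t => by simpa using ((hasDerivAt_id t).const_mul D.l).sin
  have hcc : ContinuousOn (fun t => Real.cos (D.l * t)) (Ico 0 T) := by fun_prop
  have hsc : ContinuousOn (fun t => Real.sin (D.l * t)) (Ico 0 T) := by fun_prop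
  -- in the rotating frame the momentum is constant
  have r0 := eq_of_hasDerivAt_eq ((c0.mul hcc).sub (c1.mul hsc))
    (continuousOn_const (c := D.I0 0)) (f' := fun _ => 0)
    (fun t ht => (((d0 t ht).mul (hcos t)).sub ((d1 t ht).mul (hsin t))).congr_deriv (by ring))
    (fun t _ => hasDerivAt_const t _) (by simp [i0]) t ht
  have r1 := eq_of_hasDerivAt_eq ((c0.mul hsc).add (c1.mul hcc))
    (continuousOn_const (c := D.I0 1)) (f' := fun _ => 0)
    (fun t ht => (((d0 t ht).mul (hsin t)).add ((d1 t ht).mul (hcos t))).congr_deriv (by ring))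
    (fun t _ => hasDerivAt_const t _) (by simp [i1]) t ht
  simp only [Pi.sub_apply, Pi.add_apply, Pi.mul_apply] at r0 r1
  have hsq := Real.sin_sq_add_cos_sq (D.l * t)
  rw [CauchyData.I1, CauchyData.I2, ← r0, ← r1]
  constructor
  · linear_combination -(a t) * hsq
  · linear_combination -(b t) * hsq

/-- A moment of the density excess with respect to the disc: the integral over the disc of
`g ϱ` is that of `g (ϱ - ϱ̄)` over the plane plus the contribution of the background. -/
theorem setIntegral_disc_mul_density {g : Plane → ℝ} (hg : Continuous g) {t : ℝ}
    (ht : t ∈ Ico 0 T) : ∫ x in D.disc t, g x * ρ (t, x)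
      = total (fun z => g z.2 * (ρ z - D.rhoBar)) t + D.rhoBar * ∫ x in D.disc t, g x := by
  have hv : VanishesAtRest D T U ρ p fun z => g z.2 * (ρ z - D.rhoBar) :=
    fun z _ hz => by simp [hz.2.1]
  have hρ : Continuous fun x => ρ (t, x) := continuous_slice h.contρ.continuousOn ht
  rw [← h.setIntegral_disc hv ht, ← integral_const_mul, ← integral_add]
  · congr 1 with x
    ring
  · exact integrableOn_ball (hg.mul (hρ.sub continuous_const)) _ _
  · exact integrableOn_ball (continuous_const.mul hg) _ _

theorem setIntegral_disc_mul_rho0 {g : Plane → ℝ} (hg : Continuous g) (hT : 0 < T) :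
    ∫ x in Metric.ball (0 : Plane) D.R, g x * D.rho0 x
      = total (fun z => g z.2 * (ρ z - D.rhoBar)) 0
        + D.rhoBar * ∫ x in Metric.ball (0 : Plane) D.R, g x := by
  have := h.setIntegral_disc_mul_density hg ⟨le_rfl, hT⟩
  simpa only [CauchyData.disc, D.radius_zero, h.ρ_init] using this

theorem setIntegral_disc_density {t : ℝ} (ht : t ∈ Ico 0 T) :
    ∫ x in D.disc t, ρ (t, x) = D.m + D.rhoBar * Real.pi * D.radius t ^ 2 := by
  have h1 := h.setIntegral_disc_mul_density (continuous_const (y := (1 : ℝ))) ht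
  simp only [one_mul, h.total_density ht] at h1
  rw [h1, setIntegral_const, CauchyData.disc, volume_real_ball 0 (D.radius_pos ht.1).le]
  simp
  ring

theorem setIntegral_disc_pressure {t : ℝ} (ht : t ∈ Ico 0 T) : ∫ x in D.disc t, p (t, x)
    = total (fun z => p z - D.pBar) t + D.pBar * Real.pi * D.radius t ^ 2 := by
  have hp : Continuous fun x => p (t, x) := continuous_slice h.contp.continuousOn ht
  rw [← h.setIntegral_disc vanishes_pressure ht, integral_sub, setIntegral_const,
    CauchyData.disc, volume_real_ball 0 (D.radius_pos ht.1).le]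
  · simp
    ring
  · exact integrableOn_ball hp _ _
  · exact integrableOn_ball continuous_const _ _

/-- The centre-of-mass law: the first moments of the density are `P₁` and `P₂`. -/
theorem setIntegral_disc_coord_mul_density {t : ℝ} (ht : t ∈ Ico 0 T) :
    ∫ x in D.disc t, x 0 * ρ (t, x) = D.P1 t ∧ ∫ x in D.disc t, x 1 * ρ (t, x) = D.P2 t := by
  have hT : 0 < T := ht.1.trans_lt ht.2
  have hc : ∀ i : Fin 2, Continuous fun x : Plane => x i := fun i => by fun_prop
  have key : ∀ (i : Fin 2) (I : ℝ → ℝ), Continuous I →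
      (∀ t ∈ Ico 0 T, total (fun z => ρ z * U i z) t = I t) →
      ∫ x in D.disc t, x i * ρ (t, x) = D.P0 i + ∫ s in (0 : ℝ)..t, I s := by
    intro i I hI hIt
    have hP0 : D.P0 i = total (fun z => z.2 i * (ρ z - D.rhoBar)) 0 := by
      have := h.setIntegral_disc_mul_rho0 (hc i) hT
      rw [integral_ball_coord, mul_zero, add_zero] at this
      rw [← this, CauchyData.P0]
      simp only [mul_comm]
    rw [h.setIntegral_disc_mul_density (hc i) ht, CauchyData.disc, integral_ball_coord, mul_zero,
      add_zero, hP0]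
    obtain ⟨h1, h2⟩ := h.total_coord_mul_law i (s := fun _ => 0) (h.contρ.sub contDiffOn_const)
      h.contDiffOn_massFlux vanishes_density vanishes_massFlux fun t ht x => h.mass_law ht x
    refine eq_of_hasDerivAt_eq h1
      (continuous_const.add (continuous_integral_zero hI)).continuousOn
      (fun t ht => ?_) (fun t _ => (hasDerivAt_integral_zero hI t).const_add _) (by simp) t ht
    have := h2 t ht
    simp only [mul_zero, zero_add] at this
    rwa [hIt t (Ioo_subset_Ico_self ht)] at this
  refine ⟨key 0 D.I1 ?_ fun t ht => (h.total_momentum ht).1,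
    key 1 D.I2 ?_ fun t ht => (h.total_momentum ht).2⟩
  · unfold CauchyData.I1; fun_prop
  · unfold CauchyData.I2; fun_prop

end IsFlow

/-! ### The virial identity and the entropy bound -/

namespace IsFlow

variable {D : CauchyData} {T : ℝ} {U : Fin 2 → ℝ × Plane → ℝ} {ρ p : ℝ × Plane → ℝ}

/-- The moment `∫ x_a ϱ u_i` of the momentum. -/
def momentumMoment (U : Fin 2 → ℝ × Plane → ℝ) (ρ : ℝ × Plane → ℝ) (a i : Fin 2) : ℝ → ℝ :=
  total fun z => z.2 a * (ρ z * U i z)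

/-- The virial `∫ ϱ u·x`. -/
def virial (U : Fin 2 → ℝ × Plane → ℝ) (ρ : ℝ × Plane → ℝ) (t : ℝ) : ℝ :=
  momentumMoment U ρ 0 0 t + momentumMoment U ρ 1 1 t

/-- The integral `∫ ϱ u·x_⊥`. -/
def angular (U : Fin 2 → ℝ × Plane → ℝ) (ρ : ℝ × Plane → ℝ) (t : ℝ) : ℝ :=
  momentumMoment U ρ 1 0 t - momentumMoment U ρ 0 1 t

/-- The total kinetic energy. -/
def kinetic (U : Fin 2 → ℝ × Plane → ℝ) (ρ : ℝ × Plane → ℝ) : ℝ → ℝ :=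
  total fun z => 1 / 2 * (ρ z * (U 0 z ^ 2 + U 1 z ^ 2))

/-- The total pressure excess `∫ (p - p̄)`. -/
def pressureExcess (D : CauchyData) (p : ℝ × Plane → ℝ) : ℝ → ℝ := total fun z => p z - D.pBar

/-- The second moment `∫ |x|² (ϱ - ϱ̄)` of the density excess. -/
def inertiaExcess (D : CauchyData) (ρ : ℝ × Plane → ℝ) : ℝ → ℝ :=
  total fun z => ‖z.2‖ ^ 2 * (ρ z - D.rhoBar)

theorem integrableOn_momentumMoment_init (a i : Fin 2) :
    IntegrableOn (fun x : Plane => x a * (D.rho0 x * D.u0 x i)) (Metric.ball 0 D.R) := by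
  refine integrableOn_ball ?_ _ _
  have := D.contDiff_rho0.continuous
  have := D.contDiff_u0.continuous
  fun_prop

variable (h : IsFlow D T U ρ p)
include h

theorem hasDerivAt_inertiaExcess : ContinuousOn (inertiaExcess D ρ) (Ico 0 T) ∧
    ∀ t ∈ Ioo 0 T, HasDerivAt (inertiaExcess D ρ) (2 * virial U ρ t) t := by
  have hψ : ContDiff ℝ 1 fun z : ℝ × Plane => z.2 0 ^ 2 + z.2 1 ^ 2 :=
    ((contDiff_coord 0).pow 2).add ((contDiff_coord 1).pow 2)
  have hd : ∀ z v : ℝ × Plane, fderiv ℝ (fun z : ℝ × Plane => z.2 0 ^ 2 + z.2 1 ^ 2) z v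
      = 2 * (z.2 0 * v.2 0 + z.2 1 * v.2 1) := by
    intro z v
    rw [(((hasFDerivAt_coord 0 z).pow 2).fun_add ((hasFDerivAt_coord 1 z).pow 2)).fderiv]
    simp only [smul_apply, add_apply, smul_eq_mul, nsmul_eq_mul,
      ContinuousLinearMap.comp_apply, ContinuousLinearMap.coe_snd', PiLp.proj_apply]
    push_cast
    ring
  obtain ⟨h1, h2⟩ := weighted_balance_law (s := fun _ => 0)
    (isCompact_closedBall 0 (D.radius T)) hψ
    (h.contρ.sub contDiffOn_const) h.contDiffOn_massFlux
    (fun t ht x hx => Or.inr ⟨h.eq_zero_of_notMem vanishes_density ht hx,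
      fun j => h.eq_zero_of_notMem (vanishes_massFlux j) ht hx⟩)
    fun t ht x => h.mass_law ht x
  have he : inertiaExcess D ρ
      = fun t => ∫ x : Plane, (x 0 ^ 2 + x 1 ^ 2) * (ρ (t, x) - D.rhoBar) := by
    ext t
    simp only [inertiaExcess, total, norm_sq_eq]
  rw [he]
  refine ⟨h1, fun t ht => (h2 t ht).2.congr_deriv ?_⟩
  have hint : ∀ a, Integrable fun x : Plane => x a * (ρ (t, x) * U a (t, x)) := fun a =>
    h.integrable_slice (F := fun z => z.2 a * (ρ z * U a z))
      ((contDiff_coord a).contDiffOn.mul (h.contDiffOn_massFlux a)).continuousOn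
      (fun z _ hz => by simp [hz.1]) (Ioo_subset_Ico_self ht)
  rw [virial, momentumMoment, momentumMoment, total, total, ← integral_add (hint 0) (hint 1),
    ← integral_const_mul]
  congr 1 with x
  simp [dT, dX, hd]
  ring

theorem momentumMoment_law (a i : Fin 2) :
    ContinuousOn (momentumMoment U ρ a i) (Ico 0 T) ∧ ∀ t ∈ Ioo 0 T,
      HasDerivAt (momentumMoment U ρ a i) (total (fun z =>
        z.2 a * (-(D.l * ρ z * (![-U 1 z, U 0 z] i))) + momentumFlux D U ρ p i a z) t) t :=
  h.total_coord_mul_law a (h.contDiffOn_massFlux i) (h.contDiffOn_momentumFlux i)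
    (vanishes_massFlux i) (vanishes_momentumFlux i) fun _ ht x => h.momentum_law ht x i

theorem continuousOn_momentumMoment (a i : Fin 2) :
    ContinuousOn (momentumMoment U ρ a i) (Ico 0 T) := (h.momentumMoment_law a i).1

theorem integrable_momentumMoment (a i : Fin 2) {t : ℝ} (ht : t ∈ Ico 0 T) :
    Integrable fun x : Plane => x a * (ρ (t, x) * U i (t, x)) :=
  h.integrable_slice (F := fun z => z.2 a * (ρ z * U i z))
    ((contDiff_coord a).contDiffOn.mul (h.contDiffOn_massFlux i)).continuousOn
    (fun z _ hz => by simp [hz.1]) ht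

theorem integrable_momentumFlux (i j : Fin 2) {t : ℝ} (ht : t ∈ Ico 0 T) :
    Integrable fun x : Plane => momentumFlux D U ρ p i j (t, x) :=
  h.integrable_slice (h.contDiffOn_momentumFlux i j).continuousOn (vanishes_momentumFlux i j) ht

theorem integrable_kinetic {t : ℝ} (ht : t ∈ Ico 0 T) :
    Integrable fun x : Plane => 1 / 2 * (ρ (t, x) * (U 0 (t, x) ^ 2 + U 1 (t, x) ^ 2)) :=
  h.integrable_slice h.contDiffOn_kinetic.continuousOn vanishes_kinetic ht

theorem integrable_pressure {t : ℝ} (ht : t ∈ Ico 0 T) :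
    Integrable fun x : Plane => p (t, x) - D.pBar :=
  h.integrable_slice (h.contp.sub contDiffOn_const).continuousOn vanishes_pressure ht

/-- The virial identity. -/
theorem hasDerivAt_virial {t : ℝ} (ht : t ∈ Ioo 0 T) : HasDerivAt (virial U ρ)
    (2 * kinetic U ρ t + 2 * pressureExcess D p t - D.l * angular U ρ t) t := by
  have ht' := Ioo_subset_Ico_self ht
  refine (((h.momentumMoment_law 0 0).2 t ht).add ((h.momentumMoment_law 1 1).2 t ht)).congr_deriv
    ?_
  have e : ∀ (a b : Fin 2) (c : ℝ), (∀ x : Plane, x a * (-(D.l * ρ (t, x)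
      * (![-U 1 (t, x), U 0 (t, x)] a))) = c * (x a * (ρ (t, x) * U b (t, x)))) →
      total (fun z => z.2 a * (-(D.l * ρ z * (![-U 1 z, U 0 z] a))) + momentumFlux D U ρ p a a z) t
        = c * momentumMoment U ρ a b t + ∫ x, momentumFlux D U ρ p a a (t, x) := by
    intro a b c hab
    rw [momentumMoment, total, total, ← integral_const_mul,
      ← integral_add ((h.integrable_momentumMoment a b ht').const_mul c)
        (h.integrable_momentumFlux a a ht')]
    congr 1 with x
    rw [← hab x]
  rw [e 0 1 D.l (fun x => by simp; ring), e 1 0 (-D.l) (fun x => by simp; ring)]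
  have e2 : (∫ x, momentumFlux D U ρ p 0 0 (t, x)) + ∫ x, momentumFlux D U ρ p 1 1 (t, x)
      = 2 * kinetic U ρ t + 2 * pressureExcess D p t := by
    rw [kinetic, pressureExcess, total, total, ← integral_add (h.integrable_momentumFlux 0 0 ht')
      (h.integrable_momentumFlux 1 1 ht'), ← mul_add,
      ← integral_add (h.integrable_kinetic ht') (h.integrable_pressure ht'), ← integral_const_mul]
    congr 1 with x
    simp only [momentumFlux, if_true]
    ring
  rw [angular]
  linear_combination e2

theorem hasDerivAt_angular {t : ℝ} (ht : t ∈ Ioo 0 T) :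
    HasDerivAt (angular U ρ) (D.l * virial U ρ t) t := by
  have ht' := Ioo_subset_Ico_self ht
  refine (((h.momentumMoment_law 1 0).2 t ht).sub ((h.momentumMoment_law 0 1).2 t ht)).congr_deriv
    ?_
  have e : ∀ (a i b : Fin 2) (c : ℝ), (∀ x : Plane, x a * (-(D.l * ρ (t, x)
      * (![-U 1 (t, x), U 0 (t, x)] i))) = c * (x a * (ρ (t, x) * U b (t, x)))) →
      total (fun z => z.2 a * (-(D.l * ρ z * (![-U 1 z, U 0 z] i))) + momentumFlux D U ρ p i a z) t
        = c * momentumMoment U ρ a b t + ∫ x, momentumFlux D U ρ p i a (t, x) := by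
    intro a i b c hab
    rw [momentumMoment, total, total, ← integral_const_mul,
      ← integral_add ((h.integrable_momentumMoment a b ht').const_mul c)
        (h.integrable_momentumFlux i a ht')]
    congr 1 with x
    rw [← hab x]
  rw [e 1 0 1 D.l (fun x => by simp; ring), e 0 1 0 (-D.l) (fun x => by simp; ring)]
  have e2 : ∫ x, momentumFlux D U ρ p 0 1 (t, x) = ∫ x, momentumFlux D U ρ p 1 0 (t, x) := by
    congr 1 with x
    simp only [momentumFlux]
    norm_num
    ring
  rw [virial]
  linear_combination e2

theorem momentumMoment_init (hT : 0 < T) (a i : Fin 2) : momentumMoment U ρ a i 0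
    = ∫ x in Metric.ball (0 : Plane) D.R, x a * (D.rho0 x * D.u0 x i) := by
  have hv : VanishesAtRest D T U ρ p fun z => z.2 a * (ρ z * U i z) :=
    fun z _ hz => by simp [hz.1]
  rw [momentumMoment, ← h.setIntegral_disc hv ⟨le_rfl, hT⟩, CauchyData.disc, D.radius_zero]
  simp only [h.ρ_init, h.U_init]

theorem virial_init (hT : 0 < T) : virial U ρ 0 = D.F1 := by
  rw [virial, h.momentumMoment_init hT, h.momentumMoment_init hT, CauchyData.F1,
    ← integral_add (integrableOn_momentumMoment_init 0 0)
      (integrableOn_momentumMoment_init 1 1)]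
  congr 1 with x
  simp [PiLp.inner_apply, Fin.sum_univ_two]
  ring

theorem angular_init (hT : 0 < T) : angular U ρ 0 = D.F2 := by
  rw [angular, h.momentumMoment_init hT, h.momentumMoment_init hT, CauchyData.F2,
    ← integral_sub (integrableOn_momentumMoment_init 1 0)
      (integrableOn_momentumMoment_init 0 1)]
  congr 1 with x
  simp [PiLp.inner_apply, Fin.sum_univ_two, perp]
  ring

theorem continuousOn_virial : ContinuousOn (virial U ρ) (Ico 0 T) :=
  (h.continuousOn_momentumMoment 0 0).add (h.continuousOn_momentumMoment 1 1)

/-- The Coriolis force exchanges angular momentum with the moment of inertia. -/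
theorem angular_eq {t : ℝ} (ht : t ∈ Ico 0 T) : angular U ρ t
    = D.F2 + D.l * (1 / 2 * inertiaExcess D ρ t - 1 / 2 * inertiaExcess D ρ 0) := by
  obtain ⟨hJc, hJ⟩ := h.hasDerivAt_inertiaExcess
  refine eq_of_hasDerivAt_eq (f' := fun t => D.l * virial U ρ t)
    ((h.continuousOn_momentumMoment 1 0).sub (h.continuousOn_momentumMoment 0 1))
    (continuousOn_const.add (continuousOn_const.mul ((continuousOn_const.mul hJc).sub
      continuousOn_const))) (fun t ht => h.hasDerivAt_angular ht) (fun t ht => ?_) ?_ t ht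
  · exact (((((hJ t ht).const_mul (1 / 2)).sub_const _).const_mul D.l).const_add _).congr_deriv
      (by ring)
  · simp only [Pi.sub_apply, Pi.add_apply, Pi.mul_apply, sub_self, mul_zero, add_zero]
    exact h.angular_init (ht.1.trans_lt ht.2)

theorem kinetic_add_pressureExcess {t : ℝ} (ht : t ∈ Ico 0 T) :
    kinetic U ρ t + 1 / (D.γ - 1) * pressureExcess D p t = D.e := by
  rw [← h.total_energy ht, kinetic, pressureExcess, total, total, total, ← integral_const_mul,
    ← integral_add (h.integrable_kinetic ht) ((h.integrable_pressure ht).const_mul _)]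
  rfl

theorem kinetic_nonneg {t : ℝ} (ht : t ∈ Ico 0 T) : 0 ≤ kinetic U ρ t :=
  integral_nonneg fun x => by
    have := h.ρ_pos _ (mem_slab ht x)
    show 0 ≤ 1 / 2 * (ρ (t, x) * (U 0 (t, x) ^ 2 + U 1 (t, x) ^ 2))
    positivity

/-- Minimum principle for the entropy, from the conservation of `∫ ϱ ((S̄ - S)₊)²`. -/
theorem SBar_le_entropy (hS : ∀ x, D.SBar ≤ entropy D.γ (D.rho0 x) (D.p0 x)) {t : ℝ}
    (ht : t ∈ Ico 0 T) (x : Plane) : D.SBar ≤ entropy D.γ (ρ (t, x)) (p (t, x)) := by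
  obtain ⟨h1, h2⟩ := h.total_law (s := fun _ => 0) h.contDiffOn_entropyDeficit
    (fun j => h.contDiffOn_entropyDeficit.mul (h.contU j)) vanishes_entropyDeficit
    (fun j z hz hr => by simp [vanishes_entropyDeficit z hz hr])
    fun t ht x => h.entropyDeficit_law ht x
  have h0 : total (entropyDeficit D ρ p) t = 0 := by
    refine eq_of_hasDerivAt_eq h1 continuousOn_const h2 (fun t _ => ?_) ?_ t ht
    · simpa [total] using hasDerivAt_const t (0 : ℝ)
    · refine integral_eq_zero_of_ae (Eventually.of_forall fun x => ?_)
      have : max (D.SBar - entropy D.γ (D.rho0 x) (D.p0 x)) 0 = 0 :=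
        max_eq_right (sub_nonpos.2 (hS x))
      simp [entropyDeficit, h.ρ_init, h.p_init, this]
  have hnn : ∀ x, 0 ≤ entropyDeficit D ρ p (t, x) := fun x =>
    mul_nonneg (h.ρ_pos _ (mem_slab ht x)).le (sq_nonneg _)
  have hc := h.contDiffOn_entropyDeficit.continuousOn
  have h3 := (integral_eq_zero_iff_of_nonneg hnn
    (h.integrable_slice hc vanishes_entropyDeficit ht)).1 h0
  have h4 := congrFun (((continuous_slice hc ht).ae_eq_iff_eq volume continuous_const).1 h3) x
  have h5 := (mul_eq_zero.1 h4).resolve_left (h.ρ_pos _ (mem_slab ht x)).ne'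
  have h6 := max_eq_right_iff.1 (pow_eq_zero_iff two_ne_zero |>.1 h5)
  linarith

theorem exp_mul_rpow_le_pressure (hS : ∀ x, D.SBar ≤ entropy D.γ (D.rho0 x) (D.p0 x)) {t : ℝ}
    (ht : t ∈ Ico 0 T) (x : Plane) : Real.exp D.SBar * ρ (t, x) ^ D.γ ≤ p (t, x) := by
  have hz := mem_slab ht x
  rw [state_equation D.γ _ _ (h.ρ_pos _ hz) (h.p_pos _ hz)]
  exact mul_le_mul_of_nonneg_right (Real.exp_le_exp.2 (h.SBar_le_entropy hS ht x))
    (Real.rpow_nonneg (h.ρ_pos _ hz).le _)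

/-- By the entropy bound and the convexity of `r ↦ exp S̄ · r ^ γ`, whose tangent at `ϱ̄` has
slope `σ²`, the pressure excess dominates `σ²` times the mass excess. -/
theorem sq_σ_mul_m_le (hS : ∀ x, D.SBar ≤ entropy D.γ (D.rho0 x) (D.p0 x)) {t : ℝ}
    (ht : t ∈ Ico 0 T) : D.σ ^ 2 * D.m ≤ pressureExcess D p t := by
  rw [← h.total_density ht, pressureExcess, total, total, ← integral_const_mul]
  refine integral_mono ((h.integrable_slice (h.contρ.sub contDiffOn_const).continuousOn
    vanishes_density ht).const_mul _) (h.integrable_pressure ht) fun x => ?_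
  have hb := D.rhoBar_pos
  have hρ := h.ρ_pos _ (mem_slab ht x)
  have hp := h.exp_mul_rpow_le_pressure hS ht x
  have hpb : D.pBar = Real.exp D.SBar * D.rhoBar ^ D.γ :=
    state_equation D.γ _ _ hb D.pBar_pos
  have hB := one_add_mul_self_le_rpow_one_add
    (s := ρ (t, x) / D.rhoBar - 1) (by linarith [div_pos hρ hb]) D.one_lt_γ.le
  rw [add_sub_cancel, Real.div_rpow hρ.le hb.le, le_div_iff₀ (Real.rpow_pos_of_pos hb _)] at hB
  have h1 := mul_le_mul_of_nonneg_left hB (Real.exp_pos D.SBar).le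
  simp only
  rw [D.sq_σ, Real.rpow_sub_one hb.ne', hpb]
  refine le_trans (le_of_eq ?_) (sub_le_sub_right (h1.trans hp) _)
  field_simp
  ring

end IsFlow

/-! ### Bounds for the moment of inertia -/

theorem CauchyData.continuous_q (D : CauchyData) : Continuous D.q := by
  have := D.continuous_radius
  unfold CauchyData.q
  fun_prop

theorem CauchyData.continuous_phiPlus (D : CauchyData) : Continuous D.phiPlus := by
  have := D.continuous_radius
  unfold CauchyData.phiPlus
  fun_prop

/-- The double primitive of `k` plus a quadratic polynomial solves `g'' = k + A`. -/
theorem hasDerivAt_double_primitive {k : ℝ → ℝ} (hk : Continuous k) (A b c t : ℝ) :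
    HasDerivAt (fun t => (∫ τ in (0 : ℝ)..t, ∫ s in (0 : ℝ)..τ, k s) + A / 2 * t ^ 2 + b * t + c)
      ((∫ s in (0 : ℝ)..t, k s) + A * t + b) t ∧
    HasDerivAt (fun t => (∫ s in (0 : ℝ)..t, k s) + A * t + b) (k t + A) t := by
  have h1 := hasDerivAt_integral_zero (continuous_integral_zero hk) t
  have h2 := hasDerivAt_integral_zero hk t
  constructor
  · refine (((h1.add ((hasDerivAt_pow 2 t).const_mul (A / 2))).add
      ((hasDerivAt_id t).const_mul b)).add_const c).congr_deriv ?_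
    push_cast
    ring
  · refine ((h2.add ((hasDerivAt_id t).const_mul A)).add_const b).congr_deriv ?_
    ring

theorem CauchyData.continuous_gPlus (D : CauchyData) : Continuous D.gPlus :=
  continuous_iff_continuousAt.2 fun t =>
    (hasDerivAt_double_primitive D.continuous_q D.A1 D.dG0 D.G0 t).1.continuousAt

theorem CauchyData.continuous_gMinus (D : CauchyData) : Continuous D.gMinus :=
  continuous_iff_continuousAt.2 fun t => (hasDerivAt_double_primitive
    (D.continuous_q.sub (continuous_const.mul D.continuous_phiPlus))
    D.A0 D.dG0 D.G0 t).1.continuousAt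

/-- The total mass in the disc at time `0` is positive. -/
theorem CauchyData.mass_pos (D : CauchyData) : 0 < D.m + D.rhoBar * Real.pi * D.R ^ 2 := by
  have hc := D.contDiff_rho0.continuous
  have hi := integrableOn_ball hc 0 D.R
  have h1 : D.m + D.rhoBar * Real.pi * D.R ^ 2 = ∫ x in Metric.ball (0 : Plane) D.R, D.rho0 x := by
    rw [CauchyData.m, integral_sub hi (integrableOn_ball continuous_const 0 D.R),
      setIntegral_const, volume_real_ball 0 D.R_pos.le]
    simp
    ring
  rw [h1, setIntegral_pos_iff_support_of_nonneg_ae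
    (Eventually.of_forall fun x => (D.rho0_pos x).le) hi]
  have h2 : Function.support D.rho0 = univ := by
    ext x
    simp [(D.rho0_pos x).ne']
  rw [h2, univ_inter]
  exact Metric.measure_ball_pos volume 0 D.R_pos

theorem CauchyData.mass_mono (D : CauchyData) {t : ℝ} (ht : 0 ≤ t) :
    D.m + D.rhoBar * Real.pi * D.R ^ 2 ≤ D.m + D.rhoBar * Real.pi * D.radius t ^ 2 := by
  have h1 : D.R ≤ D.radius t := by simpa [D.radius_zero] using D.radius_mono ht
  have h2 := D.R_pos
  have h3 := D.rhoBar_pos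
  gcongr

theorem CauchyData.continuousAt_phiMinus (D : CauchyData) {t : ℝ} (ht : 0 ≤ t) :
    ContinuousAt D.phiMinus t := by
  have hr := D.continuous_radius
  have h1 : Continuous D.P1 := by
    refine continuous_const.add (continuous_integral_zero ?_)
    unfold CauchyData.I1
    fun_prop
  have h2 : Continuous D.P2 := by
    refine continuous_const.add (continuous_integral_zero ?_)
    unfold CauchyData.I2
    fun_prop
  refine ContinuousAt.div (by fun_prop) (by fun_prop) ?_
  have := D.mass_pos.trans_le (D.mass_mono ht)
  positivity

theorem exists_rpow_neg_mul_le {γ a ε : ℝ} (hγ : 1 < γ) (hε : 0 < ε) :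
    ∃ μ, 0 < μ ∧ a * μ ^ (1 - γ) ≤ ε := by
  have h1 : Tendsto (fun μ : ℝ => a * μ ^ (-(γ - 1))) atTop (𝓝 (a * 0)) :=
    (tendsto_rpow_neg_atTop (by linarith)).const_mul a
  rw [mul_zero] at h1
  obtain ⟨μ, h2, h3⟩ := ((h1.eventually_le_const hε).and (eventually_gt_atTop 0)).exists
  exact ⟨μ, h3, by rwa [neg_sub] at h2⟩

namespace IsFlow

variable {D : CauchyData} {T : ℝ} {U : Fin 2 → ℝ × Plane → ℝ} {ρ p : ℝ × Plane → ℝ}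
variable (h : IsFlow D T U ρ p)
include h

theorem G_eq {t : ℝ} (ht : t ∈ Ico 0 T) : D.G (fun t x => ρ (t, x)) t
    = 1 / 2 * inertiaExcess D ρ t + D.rhoBar * Real.pi * D.radius t ^ 4 / 4 := by
  rw [CauchyData.G, h.setIntegral_disc_mul_density (g := fun x => ‖x‖ ^ 2) (by fun_prop) ht,
    CauchyData.disc, integral_ball_norm_sq (D.radius_pos ht.1).le, inertiaExcess]
  ring

theorem G_zero : D.G (fun t x => ρ (t, x)) 0 = D.G0 := by
  simp only [CauchyData.G, CauchyData.G0, CauchyData.disc, D.radius_zero, h.ρ_init]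

theorem continuousOn_G : ContinuousOn (D.G fun t x => ρ (t, x)) (Ico 0 T) := by
  have hr := D.continuous_radius
  refine ContinuousOn.congr (f := fun t => 1 / 2 * inertiaExcess D ρ t
    + D.rhoBar * Real.pi * D.radius t ^ 4 / 4) ?_ fun t ht => h.G_eq ht
  exact (continuousOn_const.mul h.hasDerivAt_inertiaExcess.1).add
    (by fun_prop : Continuous fun t => D.rhoBar * Real.pi * D.radius t ^ 4 / 4).continuousOn

theorem hasDerivAt_G {t : ℝ} (ht : t ∈ Ioo 0 T) : HasDerivAt (D.G fun t x => ρ (t, x))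
    (virial U ρ t + Real.pi * D.rhoBar * D.σ * D.radius t ^ 3) t := by
  have h1 := ((h.hasDerivAt_inertiaExcess.2 t ht).const_mul (1 / 2)).add
    ((((D.hasDerivAt_radius t).fun_pow 4).const_mul (D.rhoBar * Real.pi)).div_const 4)
  refine (h1.congr_deriv ?_).congr_of_eventuallyEq ?_
  · push_cast
    ring
  · filter_upwards [Ioo_mem_nhds ht.1 ht.2] with s hs
    exact h.G_eq (Ioo_subset_Ico_self hs)

theorem continuousOn_derivG : ContinuousOn
    (fun t => virial U ρ t + Real.pi * D.rhoBar * D.σ * D.radius t ^ 3) (Ico 0 T) := by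
  have hr := D.continuous_radius
  exact h.continuousOn_virial.add (by fun_prop :
    Continuous fun t => Real.pi * D.rhoBar * D.σ * D.radius t ^ 3).continuousOn

theorem derivG_zero (hT : 0 < T) :
    virial U ρ 0 + Real.pi * D.rhoBar * D.σ * D.radius 0 ^ 3 = D.dG0 := by
  rw [h.virial_init hT, D.radius_zero, CauchyData.dG0]

/-- The second derivative of the moment of inertia `G`. -/
theorem hasDerivAt_derivG {t : ℝ} (ht : t ∈ Ioo 0 T) :
    HasDerivAt (fun t => virial U ρ t + Real.pi * D.rhoBar * D.σ * D.radius t ^ 3)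
      (2 * kinetic U ρ t + 2 * pressureExcess D p t - D.l * D.F2 + D.l ^ 2 * D.G0 + D.q t
        - D.l ^ 2 * D.G (fun t x => ρ (t, x)) t) t := by
  have ht' := Ioo_subset_Ico_self ht
  have hT : 0 < T := ht.1.trans ht.2
  refine ((h.hasDerivAt_virial ht).add (((D.hasDerivAt_radius t).fun_pow 3).const_mul
    (Real.pi * D.rhoBar * D.σ))).congr_deriv ?_
  rw [h.angular_eq ht', h.G_eq ht', ← h.G_zero, h.G_eq ⟨le_rfl, hT⟩, D.radius_zero,
    CauchyData.q]
  push_cast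
  ring

theorem hasDerivWithinAt_G (hT : 0 < T) :
    HasDerivWithinAt (D.G fun t x => ρ (t, x)) D.dG0 (Ici 0) 0 := by
  have h0 : (0 : ℝ) ∈ Ico 0 T := ⟨le_rfl, hT⟩
  refine hasDerivWithinAt_Ici_of_tendsto_deriv (s := Ioo 0 T)
    (fun t ht => (h.hasDerivAt_G ht).differentiableAt.differentiableWithinAt)
    ((h.continuousOn_G 0 h0).mono Ioo_subset_Ico_self) (Ioo_mem_nhdsGT hT) ?_
  have h1 := ((h.continuousOn_derivG 0 h0).mono Ioo_subset_Ico_self).tendsto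
  rw [h.derivG_zero hT, nhdsWithin_Ioo_eq_nhdsGT hT] at h1
  refine h1.congr' ?_
  filter_upwards [Ioo_mem_nhdsGT hT] with t ht
  exact (h.hasDerivAt_G ht).deriv.symm

theorem G_nonneg {t : ℝ} (ht : t ∈ Ico 0 T) : 0 ≤ D.G (fun t x => ρ (t, x)) t :=
  mul_nonneg (by norm_num) (integral_nonneg fun x =>
    mul_nonneg (sq_nonneg _) (h.ρ_pos _ (mem_slab ht x)).le)

theorem integrableOn_disc_mul_density {g : Plane → ℝ} (hg : Continuous g) {t : ℝ}
    (ht : t ∈ Ico 0 T) : IntegrableOn (fun x => g x * ρ (t, x)) (D.disc t) :=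
  integrableOn_ball (hg.mul (continuous_slice h.contρ.continuousOn ht)) _ _

theorem phiPlus_sub_G {t : ℝ} (ht : t ∈ Ico 0 T) :
    D.phiPlus t - D.G (fun t x => ρ (t, x)) t
      = 1 / 2 * ∫ x in D.disc t, (D.radius t ^ 2 - ‖x‖ ^ 2) * ρ (t, x) := by
  simp only [sub_mul]
  rw [integral_sub (h.integrableOn_disc_mul_density continuous_const ht)
    (h.integrableOn_disc_mul_density (g := fun x => ‖x‖ ^ 2) (by fun_prop) ht),
    integral_const_mul, h.setIntegral_disc_density ht, CauchyData.phiPlus, CauchyData.G]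
  ring

theorem G_le_phiPlus {t : ℝ} (ht : t ∈ Ico 0 T) : D.G (fun t x => ρ (t, x)) t ≤ D.phiPlus t := by
  rw [← sub_nonneg, h.phiPlus_sub_G ht]
  refine mul_nonneg (by norm_num) (setIntegral_nonneg measurableSet_ball fun x hx => ?_)
  rw [CauchyData.disc, mem_ball_zero_iff] at hx
  exact mul_nonneg (by nlinarith [norm_nonneg x]) (h.ρ_pos _ (mem_slab ht x)).le

theorem G_le_gPlus (hγ : D.γ < 2) (hS : ∀ x, D.SBar ≤ entropy D.γ (D.rho0 x) (D.p0 x)) {t : ℝ}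
    (ht : t ∈ Ico 0 T) : D.G (fun t x => ρ (t, x)) t ≤ D.gPlus t := by
  have hT : 0 < T := ht.1.trans_lt ht.2
  have hg := hasDerivAt_double_primitive D.continuous_q D.A1 D.dG0 D.G0
  refine le_of_hasDerivAt_le h.continuousOn_G D.continuous_gPlus.continuousOn
    (fun t ht => h.hasDerivAt_G ht) (fun t _ => (hg t).1) ?_ (fun t ht => ?_) t ht
  · rw [h.G_zero]
    simp [CauchyData.gPlus, CauchyData.Q]
  refine le_of_hasDerivAt_le h.continuousOn_derivG
    (fun t _ => (hg t).2.continuousAt.continuousWithinAt) (fun t ht => h.hasDerivAt_derivG ht)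
    (fun t _ => (hg t).2) ?_ (fun t ht => ?_) t (Ioo_subset_Ico_self ht)
  · rw [h.derivG_zero hT]
    simp
  have ht' := Ioo_subset_Ico_self ht
  have hγ1 : 0 < D.γ - 1 := sub_pos.2 D.one_lt_γ
  have h1 := h.kinetic_add_pressureExcess ht'
  have h2 := h.sq_σ_mul_m_le hS ht'
  have h3 : 0 ≤ D.l ^ 2 * D.G (fun t x => ρ (t, x)) t := mul_nonneg (sq_nonneg _) (h.G_nonneg ht')
  -- the kinetic energy is eliminated, and `γ < 2` makes the coefficient of the pressure negative
  have h4 : 2 * pressureExcess D p t - 2 * (1 / (D.γ - 1) * pressureExcess D p t)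
      = 2 * (D.γ - 2) / (D.γ - 1) * pressureExcess D p t := by
    field_simp
    ring
  have h5 : 2 * (D.γ - 2) / (D.γ - 1) * pressureExcess D p t
      ≤ 2 * (D.γ - 2) / (D.γ - 1) * (D.σ ^ 2 * D.m) :=
    mul_le_mul_of_nonpos_left h2 (div_nonpos_of_nonpos_of_nonneg (by linarith) hγ1.le)
  rw [CauchyData.A1]
  linarith

theorem gMinus_le_G (hγ : D.γ < 2) {t : ℝ} (ht : t ∈ Ico 0 T) :
    D.gMinus t ≤ D.G (fun t x => ρ (t, x)) t := by
  have hT : 0 < T := ht.1.trans_lt ht.2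
  have hg := hasDerivAt_double_primitive (k := fun s => D.q s - D.l ^ 2 * D.phiPlus s)
    (D.continuous_q.sub (continuous_const.mul D.continuous_phiPlus)) D.A0 D.dG0 D.G0
  refine le_of_hasDerivAt_le D.continuous_gMinus.continuousOn h.continuousOn_G
    (fun t _ => (hg t).1) (fun t ht => h.hasDerivAt_G ht) ?_ (fun t ht => ?_) t ht
  · rw [h.G_zero]
    simp [CauchyData.gMinus, CauchyData.Q1]
  refine le_of_hasDerivAt_le (fun t _ => (hg t).2.continuousAt.continuousWithinAt)
    h.continuousOn_derivG (fun t _ => (hg t).2) (fun t ht => h.hasDerivAt_derivG ht)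
    ?_ (fun t ht => ?_) t (Ioo_subset_Ico_self ht)
  · rw [h.derivG_zero hT]
    simp
  have ht' := Ioo_subset_Ico_self ht
  have hγ1 : 0 < D.γ - 1 := sub_pos.2 D.one_lt_γ
  have h1 := h.kinetic_add_pressureExcess ht'
  have h2 : 0 ≤ (2 - D.γ) * kinetic U ρ t :=
    mul_nonneg (by linarith) (h.kinetic_nonneg ht')
  have h3 : D.l ^ 2 * D.G (fun t x => ρ (t, x)) t ≤ D.l ^ 2 * D.phiPlus t :=
    mul_le_mul_of_nonneg_left (h.G_le_phiPlus ht') (sq_nonneg _)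
  -- the pressure is eliminated, and `γ < 2` makes the coefficient of the kinetic energy positive
  have h4 : pressureExcess D p t = (D.γ - 1) * (D.e - kinetic U ρ t) := by
    rw [← h1]
    field_simp
    ring
  rw [CauchyData.A0, h4]
  linarith

theorem pressureExcess_le {t : ℝ} (ht : t ∈ Ico 0 T) :
    pressureExcess D p t ≤ (D.γ - 1) * D.e := by
  have hγ1 : 0 < D.γ - 1 := sub_pos.2 D.one_lt_γ
  have h2 := mul_nonneg hγ1.le (h.kinetic_nonneg ht)
  have h4 : (D.γ - 1) * D.e = (D.γ - 1) * kinetic U ρ t + pressureExcess D p t := by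
    rw [← h.kinetic_add_pressureExcess ht]
    field_simp
  linarith

/-! ### Absence of concentration and the life span -/

/-- The entropy bound controls the density by the pressure, with an arbitrarily small factor. -/
theorem density_le (hS : ∀ x, D.SBar ≤ entropy D.γ (D.rho0 x) (D.p0 x)) {μ : ℝ} (hμ : 0 < μ)
    {t : ℝ} (ht : t ∈ Ico 0 T) (x : Plane) :
    ρ (t, x) ≤ μ + Real.exp (-D.SBar) * μ ^ (1 - D.γ) * p (t, x) := by
  have hρ := h.ρ_pos _ (mem_slab ht x)
  have hp := h.p_pos _ (mem_slab ht x)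
  have hμ' : 0 < μ ^ (1 - D.γ) := Real.rpow_pos_of_pos hμ _
  rcases le_or_gt (ρ (t, x)) μ with hle | hlt
  · have : 0 ≤ Real.exp (-D.SBar) * μ ^ (1 - D.γ) * p (t, x) := by positivity
    linarith
  · have h1 : ρ (t, x) * μ ^ (D.γ - 1) ≤ ρ (t, x) ^ D.γ := by
      have h2 : μ ^ (D.γ - 1) ≤ ρ (t, x) ^ (D.γ - 1) :=
        Real.rpow_le_rpow hμ.le hlt.le (by linarith [D.one_lt_γ])
      rw [Real.rpow_sub_one hρ.ne' D.γ, le_div_iff₀ hρ] at h2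
      linarith
    have h3 : μ ^ (1 - D.γ) * μ ^ (D.γ - 1) = 1 := by
      rw [← Real.rpow_add hμ]
      simp
    have h4 : Real.exp (-D.SBar) * Real.exp D.SBar = 1 := by
      rw [← Real.exp_add]
      simp
    have h5 := h.exp_mul_rpow_le_pressure hS ht x
    calc ρ (t, x) = Real.exp (-D.SBar) * Real.exp D.SBar
          * (μ ^ (1 - D.γ) * (ρ (t, x) * μ ^ (D.γ - 1))) := by
            rw [h4]
            linear_combination -(ρ (t, x)) * h3
      _ ≤ Real.exp (-D.SBar) * Real.exp D.SBar * (μ ^ (1 - D.γ) * ρ (t, x) ^ D.γ) := by gcongr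
      _ = Real.exp (-D.SBar) * μ ^ (1 - D.γ) * (Real.exp D.SBar * ρ (t, x) ^ D.γ) := by ring
      _ ≤ Real.exp (-D.SBar) * μ ^ (1 - D.γ) * p (t, x) := by gcongr
      _ ≤ _ := by linarith

/-- Absence of concentration: there is a density level `μ`, uniform in time, such that every subset
`A` of the disc with `4 μ |A|` at most the initial mass carries at most half of that mass. This is
stated through a weight `w` which is at least `c` off `A`. -/
theorem exists_density_level (hS : ∀ x, D.SBar ≤ entropy D.γ (D.rho0 x) (D.p0 x)) :
    ∃ μ, 0 < μ ∧ ∀ t ∈ Ico 0 T, ∀ (w : Plane → ℝ) (A : Set Plane) (c : ℝ), Continuous w →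
      MeasurableSet A → A ⊆ D.disc t →
      4 * (μ * volume.real A) ≤ D.m + D.rhoBar * Real.pi * D.R ^ 2 → 0 ≤ c →
      (∀ x ∈ D.disc t, 0 ≤ w x) → (∀ x ∈ D.disc t, x ∉ A → c ≤ w x) →
      c * (D.m + D.rhoBar * Real.pi * D.R ^ 2) / 2 ≤ ∫ x in D.disc t, w x * ρ (t, x) := by
  set M := D.m + D.rhoBar * Real.pi * D.R ^ 2 with hM
  have hM0 : 0 < M := D.mass_pos
  set B := (D.γ - 1) * D.e + D.pBar * Real.pi * D.radius T ^ 2 with hB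
  obtain ⟨μ, hμ, hμB⟩ := exists_rpow_neg_mul_le (a := Real.exp (-D.SBar) * B) D.one_lt_γ
    (by linarith : 0 < M / 4)
  refine ⟨μ, hμ, fun t ht w A c hw hA hAd hAμ hc hw0 hwc => ?_⟩
  set a := Real.exp (-D.SBar) * μ ^ (1 - D.γ) with ha
  have ha0 : 0 ≤ a := by positivity
  have hp : Continuous fun x => p (t, x) := continuous_slice h.contp.continuousOn ht
  have hρ : Continuous fun x => ρ (t, x) := continuous_slice h.contρ.continuousOn ht
  have hpB : ∫ x in D.disc t, p (t, x) ≤ B := by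
    rw [h.setIntegral_disc_pressure ht, hB]
    have h1 := h.pressureExcess_le ht
    have h2 : D.radius t ^ 2 ≤ D.radius T ^ 2 :=
      pow_le_pow_left₀ (D.radius_pos ht.1).le (D.radius_mono ht.2.le) 2
    have h3 := D.pBar_pos
    have h4 := mul_le_mul_of_nonneg_left h2 (by positivity : 0 ≤ D.pBar * Real.pi)
    rw [pressureExcess] at h1
    linarith
  have hIA : IntegrableOn (A.indicator fun _ => μ) (D.disc t) :=
    (integrableOn_ball (continuous_const (y := μ)) 0 (D.radius t)).indicator hA
  have hIρ : IntegrableOn (fun x => ρ (t, x)) (D.disc t) := integrableOn_ball hρ _ _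
  have hIp : IntegrableOn (fun x => a * p (t, x)) (D.disc t) :=
    integrableOn_ball (continuous_const.mul hp) _ _
  have hpt : ∫ x in D.disc t, c * (ρ (t, x) - A.indicator (fun _ => μ) x - a * p (t, x))
      ≤ ∫ x in D.disc t, w x * ρ (t, x) := by
    refine setIntegral_mono_on (((hIρ.sub hIA).sub hIp).const_mul c)
      (h.integrableOn_disc_mul_density hw ht) measurableSet_ball fun x hx => ?_
    have hρ0 := h.ρ_pos _ (mem_slab ht x)
    have hp0 := h.p_pos _ (mem_slab ht x)
    have hd := h.density_le hS hμ ht x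
    -- on `A` the left-hand side is nonpositive, by `density_le`
    by_cases hxA : x ∈ A
    · rw [indicator_of_mem hxA]
      have h1 : c * (ρ (t, x) - μ - a * p (t, x)) ≤ 0 :=
        mul_nonpos_of_nonneg_of_nonpos hc (by linarith)
      exact h1.trans (mul_nonneg (hw0 x hx) hρ0.le)
    · rw [indicator_of_notMem hxA]
      have h1 := mul_le_mul_of_nonneg_right (hwc x hx hxA) hρ0.le
      have h2 : 0 ≤ c * (a * p (t, x)) := by positivity
      linarith
  refine le_trans ?_ hpt
  have hIρA : IntegrableOn (fun x => ρ (t, x) - A.indicator (fun _ => μ) x) (D.disc t) :=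
    hIρ.sub hIA
  rw [integral_const_mul, integral_sub hIρA hIp, integral_sub hIρ hIA,
    setIntegral_indicator hA, inter_eq_self_of_subset_right hAd, setIntegral_const,
    integral_const_mul, h.setIntegral_disc_density ht, smul_eq_mul]
  have h1 := D.mass_mono ht.1
  have h2 : a * ∫ x in D.disc t, p (t, x) ≤ M / 4 :=
    (mul_le_mul_of_nonneg_left hpB ha0).trans (le_trans (le_of_eq (by rw [ha]; ring)) hμB)
  have h3 := mul_le_mul_of_nonneg_left (show M / 2 ≤ D.m + D.rhoBar * Real.pi * D.radius t ^ 2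
    - volume.real A * μ - a * ∫ x in D.disc t, p (t, x) by linarith) hc
  linarith

/-- The bounds `φ₋ ≤ G ≤ φ₊` are strict, with a gap that is uniform up to the final time. -/
theorem exists_gap (hT : 0 < T) (hS : ∀ x, D.SBar ≤ entropy D.γ (D.rho0 x) (D.p0 x)) :
    ∃ δ, 0 < δ ∧ ∀ t ∈ Ico 0 T, D.phiMinus t + δ ≤ D.G (fun t x => ρ (t, x)) t ∧
      D.G (fun t x => ρ (t, x)) t + δ ≤ D.phiPlus t := by
  obtain ⟨μ, hμ, hlevel⟩ := h.exists_density_level hS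
  set M := D.m + D.rhoBar * Real.pi * D.R ^ 2 with hM
  have hM0 : 0 < M := D.mass_pos
  have hπ := Real.pi_pos
  have hR := D.R_pos
  have hrT := D.radius_pos hT.le
  -- `ε` bounds the radius of a small disc, and the width of a thin annulus, of small mass
  obtain ⟨ε, hε, hε1, hε2, hεR⟩ : ∃ ε, 0 < ε ∧ 4 * (μ * (Real.pi * ε ^ 2)) ≤ M ∧
      4 * (μ * (2 * Real.pi * D.radius T * ε)) ≤ M ∧ ε < D.R := by
    have e1 : ∀ᶠ ε : ℝ in 𝓝[>] 0, 4 * (μ * (Real.pi * ε ^ 2)) < M :=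
      ((by fun_prop : Continuous fun ε : ℝ => 4 * (μ * (Real.pi * ε ^ 2))).continuousAt
        |>.eventually_lt_const (by simpa using hM0)).filter_mono nhdsWithin_le_nhds
    have e2 : ∀ᶠ ε : ℝ in 𝓝[>] 0, 4 * (μ * (2 * Real.pi * D.radius T * ε)) < M :=
      ((by fun_prop : Continuous fun ε : ℝ =>
        4 * (μ * (2 * Real.pi * D.radius T * ε))).continuousAt
        |>.eventually_lt_const (by simpa using hM0)).filter_mono nhdsWithin_le_nhds
    obtain ⟨ε, ⟨h1, h2⟩, h3⟩ := ((e1.and e2).and (Ioo_mem_nhdsGT hR)).exists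
    exact ⟨ε, h3.1, h1.le, h2.le, h3.2⟩
  refine ⟨min (ε ^ 2 * M / 4) (D.R * ε * M / 4), lt_min (by positivity) (by positivity),
    fun t ht => ⟨?_, ?_⟩⟩
  · refine (add_le_add_right (min_le_left _ _) _).trans ?_
    set N := D.m + D.rhoBar * Real.pi * D.radius t ^ 2 with hN
    have hN0 : 0 < N := hM0.trans_le (D.mass_mono ht.1)
    -- the centre of mass
    set X : Plane := !₂[D.P1 t / N, D.P2 t / N] with hX
    have hX0 : X 0 = D.P1 t / N := rfl
    have hX1 : X 1 = D.P2 t / N := rfl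
    have hvol : volume.real (Metric.ball X ε ∩ D.disc t) ≤ Real.pi * ε ^ 2 := by
      rw [← volume_real_ball X hε.le]
      exact measureReal_mono inter_subset_left (measure_ball_lt_top).ne
    have hlow := hlevel t ht (fun x => ‖x - X‖ ^ 2) (Metric.ball X ε ∩ D.disc t) (ε ^ 2)
      (by fun_prop) (measurableSet_ball.inter measurableSet_ball) inter_subset_right
      (le_trans (by gcongr) hε1) (sq_nonneg _) (fun x _ => sq_nonneg _) (fun x hx hxA => by
        have : x ∉ Metric.ball X ε := fun hc => hxA ⟨hc, hx⟩
        rw [Metric.mem_ball, dist_eq_norm, not_lt] at this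
        exact pow_le_pow_left₀ hε.le this 2)
    have hexp : ∫ x in D.disc t, ‖x - X‖ ^ 2 * ρ (t, x)
        = 2 * D.G (fun t x => ρ (t, x)) t - 2 * D.phiMinus t := by
      obtain ⟨hP1, hP2⟩ := h.setIntegral_disc_coord_mul_density ht
      have hsq : ∀ x : Plane, ‖x - X‖ ^ 2 * ρ (t, x) = ‖x‖ ^ 2 * ρ (t, x)
          - (2 * X 0) * (x 0 * ρ (t, x)) - (2 * X 1) * (x 1 * ρ (t, x))
          + (X 0 ^ 2 + X 1 ^ 2) * ρ (t, x) := by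
        intro x
        rw [norm_sq_eq, norm_sq_eq]
        simp only [PiLp.sub_apply]
        ring
      have i1 := h.integrableOn_disc_mul_density (g := fun x => ‖x‖ ^ 2) (by fun_prop) ht
      have i2 := (h.integrableOn_disc_mul_density (g := fun x => x 0) (by fun_prop) ht).const_mul
        (2 * X 0)
      have i3 := (h.integrableOn_disc_mul_density (g := fun x => x 1) (by fun_prop) ht).const_mul
        (2 * X 1)
      have i4 := h.integrableOn_disc_mul_density
        (continuous_const (y := X 0 ^ 2 + X 1 ^ 2)) ht
      have i12 : IntegrableOn (fun x => ‖x‖ ^ 2 * ρ (t, x) - (2 * X 0) * (x 0 * ρ (t, x)))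
          (D.disc t) := i1.sub i2
      have i123 : IntegrableOn (fun x => ‖x‖ ^ 2 * ρ (t, x) - (2 * X 0) * (x 0 * ρ (t, x))
          - (2 * X 1) * (x 1 * ρ (t, x))) (D.disc t) := i12.sub i3
      simp_rw [hsq]
      rw [integral_add i123 i4, integral_sub i12 i3, integral_sub i1 i2,
        integral_const_mul, integral_const_mul, integral_const_mul, hP1, hP2,
        h.setIntegral_disc_density ht, CauchyData.G, CauchyData.phiMinus, ← hN, hX0, hX1]
      field_simp
      ring
    rw [hexp] at hlow
    linarith
  · refine (add_le_add_right (min_le_right _ _) _).trans ?_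
    have hr := D.radius_pos ht.1
    have hRr : D.R ≤ D.radius t := by simpa [D.radius_zero] using D.radius_mono ht.1
    have hrr : D.radius t ≤ D.radius T := D.radius_mono ht.2.le
    have hsub : Metric.ball (0 : Plane) (D.radius t - ε) ⊆ D.disc t :=
      Metric.ball_subset_ball (by linarith)
    have hvol : volume.real (D.disc t \ Metric.ball (0 : Plane) (D.radius t - ε))
        ≤ 2 * Real.pi * D.radius T * ε := by
      rw [measureReal_sdiff hsub measurableSet_ball measure_ball_lt_top.ne, CauchyData.disc,
        volume_real_ball 0 hr.le, volume_real_ball 0 (by linarith)]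
      have h1 := mul_le_mul_of_nonneg_left hrr (by positivity : 0 ≤ 2 * Real.pi * ε)
      nlinarith [mul_pos hπ (pow_pos hε 2)]
    have hlow := hlevel t ht (fun x => D.radius t ^ 2 - ‖x‖ ^ 2)
      (D.disc t \ Metric.ball (0 : Plane) (D.radius t - ε)) (D.R * ε)
      (by fun_prop) (measurableSet_ball.diff measurableSet_ball) sdiff_subset
      (le_trans (by gcongr) hε2) (by positivity) (fun x hx => by
        rw [CauchyData.disc, mem_ball_zero_iff] at hx
        nlinarith [norm_nonneg x]) (fun x hx hxA => by
        have : x ∈ Metric.ball (0 : Plane) (D.radius t - ε) := by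
          by_contra hc
          exact hxA ⟨hx, hc⟩
        rw [mem_ball_zero_iff] at this
        nlinarith [norm_nonneg x])
    have := h.phiPlus_sub_G ht
    linarith

/-- If one of the bounds `g₊`, `g₋` for `G` meets the bound `φ₋`, `φ₊` from the other side at the
time `T_*`, the flow ends before `T_*`. -/
theorem lifespan_lt (hT : 0 < T) (hγ : D.γ < 2)
    (hS : ∀ x, D.SBar ≤ entropy D.γ (D.rho0 x) (D.p0 x)) {Tstar : ℝ} (hTs : 0 < Tstar)
    (hmeet : D.gPlus Tstar = D.phiMinus Tstar ∨ D.gMinus Tstar = D.phiPlus Tstar) :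
    T < Tstar := by
  by_contra! hle
  obtain ⟨δ, hδ, hgap⟩ := h.exists_gap hT hS
  -- the solution need not exist at `T_*`, so the gap is passed to the limit from the left
  have hev : ∀ᶠ t in 𝓝[<] Tstar, t ∈ Ico 0 T := by
    filter_upwards [Ioo_mem_nhdsLT hTs] with t ht
    exact ⟨ht.1.le, ht.2.trans_le hle⟩
  have hleft : 𝓝[<] Tstar ≤ 𝓝 Tstar := nhdsWithin_le_nhds
  rcases hmeet with hm | hm
  · have hlim := le_of_tendsto_of_tendsto
      (((D.continuousAt_phiMinus hTs.le).tendsto.mono_left hleft).add_const δ)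
      (D.continuous_gPlus.continuousAt.tendsto.mono_left hleft)
      (hev.mono fun t ht => (hgap t ht).1.trans (h.G_le_gPlus hγ hS ht))
    linarith
  · have hlim := le_of_tendsto_of_tendsto
      ((D.continuous_gMinus.continuousAt.tendsto.mono_left hleft).add_const δ)
      (D.continuous_phiPlus.continuousAt.tendsto.mono_left hleft)
      (hev.mono fun t ht =>
        (add_le_add_left (h.gMinus_le_G hγ ht) δ).trans (hgap t ht).2)
    linarith

end IsFlow

end RotGas

end

theorem theorem3 (D : RotGas.CauchyData) (hγ : D.γ < 2)
    (hS : ∀ x : RotGas.Plane, D.SBar ≤ RotGas.entropy D.γ (D.rho0 x) (D.p0 x)) :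
    (∀ (T : ℝ) (u : ℝ → RotGas.Plane → RotGas.Plane) (rho p : ℝ → RotGas.Plane → ℝ),
      0 < T → RotGas.IsClassicalSolution D T u rho p →
        HasDerivWithinAt (D.G rho) D.dG0 (Set.Ici 0) 0 ∧
        ∀ t ∈ Set.Ico 0 T, D.gMinus t ≤ D.G rho t ∧ D.G rho t ≤ D.gPlus t) ∧
    (∀ Tstar : ℝ, 0 < Tstar →
      (D.gPlus Tstar = D.phiMinus Tstar ∨ D.gMinus Tstar = D.phiPlus Tstar) →
        ∀ (T : ℝ) (u : ℝ → RotGas.Plane → RotGas.Plane) (rho p : ℝ → RotGas.Plane → ℝ),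
          0 < T → RotGas.IsClassicalSolution D T u rho p → T < Tstar) := by
  refine ⟨fun T u rho p hT hsol => ⟨hsol.isFlow.hasDerivWithinAt_G hT, fun t ht =>
    ⟨hsol.isFlow.gMinus_le_G hγ ht, hsol.isFlow.G_le_gPlus hγ hS ht⟩⟩, ?_⟩
  exact fun Tstar hTs hmeet T u rho p hT hsol => hsol.isFlow.lifespan_lt hT hγ hS hTs hmeet
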